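/- For $f:\mathbb{Z}^2\to\mathbb{C}$ put $(\Delta f)(i,j)=4f(i,j)-f(i-1,j)-f(i+1,j)-f(i,j-1)-f(i,j+1)$, and call $f$ harmonic modulo $1$ if $(\Delta f)(i,j)\in\mathbb{Z}$ for all $(i,j)\in\mathbb{Z}^2$. For $1\le p<\infty$ let $\mathscr{H}^p(\mathbb{Z}^2)$ be the set of all $f:\mathbb{Z}^2\to\mathbb{C}$ that are harmonic modulo $1$ and satisfy $\sum_{x\in\mathbb{Z}^2}|f(x)|^p<\infty$. Let $\nu=\frac14\left(\delta_{(-1,0)}+\delta_{(1,0)}+\delta_{(0,-1)}+\delta_{(0,1)}\right)$, where $\delta_y$ is the unit point mass at $y$, let $\nu^{*n}$ be its $n$-th convolution power ($\nu^{*0}=\delta_{(0,0)}$), and let $$G(x)=\lim_{N\to\infty}\frac14\sum_{n=0}^{N-1}\left[\nu^{*n}(x)-\nu^{*n}(0,0)\right],\qquad x\in\mathbb{Z}^2,$$ be the Green's function on $\mathbb{Z}^2$. Let $D_1f(i,j)=f(i+1,j)-f(i,j)$ and $D_2f(i,j)=f(i,j+1)-f(i,j)$, and let $\mathbf{e}_{(0,0)}$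 be the indicator function of the origin. Let $\langle\langle f_1,\dots,f_n\rangle\rangle$ be the set of all finite linear combinations with integer coefficients of translates $f_k(\cdot-y)$, $y\in\mathbb{Z}^2$, $1\le k\le n$. Theorem. The limit defining $G(x)$ exists for every $x\in\mathbb{Z}^2$, and $$\mathscr{H}^1(\mathbb{Z}^2)=\langle\langle D_1^3G,\ D_1^2D_2G,\ D_1D_2^2G,\ D_2^3G,\ \mathbf{e}_{(0,0)}\rangle\rangle,$$ $$\mathscr{H}^p(\mathbb{Z}^2)=\langle\langle D_1^2G,\ D_1D_2G,\ D_2^2G\rangle\rangle\qquad(1<p\le 2),$$ $$\mathscr{H}^p(\mathbb{Z}^2)=\langle\langle D_1G,\ D_2G\rangle\rangle\qquad(2<p<\infty).$$ -/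

import Mathlib

open Filter Topology
open scoped ENNReal

noncomputable section

/-- The graph Laplacian on `ℤ²`. -/
def graphLaplacian (f : ℤ × ℤ → ℂ) (x : ℤ × ℤ) : ℂ :=
  4 * f x - f (x.1 - 1, x.2) - f (x.1 + 1, x.2) - f (x.1, x.2 - 1) - f (x.1, x.2 + 1)

/-- `f` is harmonic modulo 1: its graph Laplacian takes values in `ℤ` everywhere. -/
def HarmonicModOne (f : ℤ × ℤ → ℂ) : Prop :=
  ∀ x : ℤ × ℤ, ∃ n : ℤ, graphLaplacian f x = (n : ℂ)

/-- The set of all functions in `ℓ^p(ℤ²)` that are harmonic modulo 1. -/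
def harmonicModOneLp (p : ℝ≥0∞) : Set (ℤ × ℤ → ℂ) :=
  {f | Memℓp f p ∧ HarmonicModOne f}

/-- The driving measure of simple random walk on `ℤ²`, as a finitely supported function in the
group algebra `ℝ[ℤ²]`. Multiplication there is convolution, so `srwStep ^ n` is the `n`-th
convolution power. -/
def srwStep : AddMonoidAlgebra ℝ (ℤ × ℤ) :=
  AddMonoidAlgebra.single (-1, 0) (1 / 4) + AddMonoidAlgebra.single (1, 0) (1 / 4) +
    AddMonoidAlgebra.single (0, -1) (1 / 4) + AddMonoidAlgebra.single (0, 1) (1 / 4)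

/-- Partial sums (over `n < N`) of the series that defines the Green's function. -/
def greenPartialSum (N : ℕ) (x : ℤ × ℤ) : ℝ :=
  1 / 4 * ∑ n ∈ Finset.range N, ((srwStep ^ n).coeff x - (srwStep ^ n).coeff (0, 0))

/-- The Green's function on `ℤ²`, with values in `ℝ ⊆ ℂ`. The series converges only conditionally
at sites of odd parity, so its sum is the limit of the partial sums, not an unordered sum. -/
def greenZ2 (x : ℤ × ℤ) : ℂ :=
  ((limUnder atTop (fun N : ℕ => greenPartialSum N x) : ℝ) : ℂ)

/-- Discrete derivative in the first coordinate. -/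
def discD1 (f : ℤ × ℤ → ℂ) (x : ℤ × ℤ) : ℂ := f (x.1 + 1, x.2) - f x

/-- Discrete derivative in the second coordinate. -/
def discD2 (f : ℤ × ℤ → ℂ) (x : ℤ × ℤ) : ℂ := f (x.1, x.2 + 1) - f x

/-- The indicator function of the origin. -/
def basisZero (x : ℤ × ℤ) : ℂ := if x = (0, 0) then 1 else 0

/-- The translation operator. -/
def translateZ2 (y : ℤ × ℤ) (f : ℤ × ℤ → ℂ) (x : ℤ × ℤ) : ℂ := f (x - y)

/-- All finite integer linear combinations of translates of members of `S`. -/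
def translateSpan (S : Set (ℤ × ℤ → ℂ)) : Submodule ℤ (ℤ × ℤ → ℂ) :=
  Submodule.span ℤ {g | ∃ f ∈ S, ∃ y : ℤ × ℤ, g = translateZ2 y f}

end

/-!
The Laplacian `Δ` of a function `f` in `ℓ^p`, `p < ∞`, that is harmonic modulo one is integer valued
and tends to zero, so it is finitely supported, i.e. an element `a` of the group ring `ℤ[ℤ²]`, which
acts on functions by convolution. The Green's function `G` satisfies `Δ G = δ`, and a harmonic
function that vanishes at infinity is zero, so `f = a * G` as soon as `a * G` is in `ℓ^p`. It remains
to find out which `a` occur, and this has two halves.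

*Differences of order `k` of `G` are in `ℓ^p` when `k * p > 2`* (`memℓp_act_greenZ2`). In diagonal
coordinates simple random walk is a product of two independent walks on `ℤ`, so `stepSum ^ n` factors
as `x⁻ⁿ (1 + s)ⁿ (1 + t)ⁿ` in the group ring, where `x`, `s`, `t` are the group elements `(1, 0)`,
`(1, 1)`, `(1, -1)` (`stepSum_pow`). The identity
`(n + 1) (s - 1) (1 + s)ⁿ = ∑ k, C(n + 1, k) (2 k - n - 1) sᵏ` and the variance of the binomial
distribution show that a diagonal difference of the `n`-step distribution has `ℓ¹` norm
`O(n ^ (-1/2))`. A unit difference changes parity, and becomes a combination of diagonal differences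
only after multiplication by `4 + stepSum` (`l1Decay_diff`); this factor is harmless, since it equals
`8 - Δ` and `Δ G = δ`. As the `ℓ¹` norm is submultiplicative, splitting `n` steps into parts gives
`ℓ¹` norm `O(n ^ (-k/2))` and sup norm `O(n ^ (-1 - k/2))` for differences of order `k`, hence
`ℓ^p` norm `O(n ^ (-1 - k/2 + 1/p))`, which is summable over `n`. The same bounds give the
convergence of the series defining `G`.

*The element `a` annihilates the harmonic polynomials of degree `m` when `m * p ≤ 2`*
(`act_eq_zero_of_hasCutoffs`). Cutting a harmonic polynomial off at scale `R`, one gets a function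
whose Laplacian is `O(R ^ (m - 2))`, lives on `O(R ^ 2)` sites and tends to zero pointwise, so that
its pairing with `f` tends to zero by Hölder's inequality; summation by parts turns this pairing into
the pairing of the cutoff with `a`. The polynomials `1`; `i`, `j`; `i * j`, `i ^ 2 - j ^ 2` then place
`a` in the ideal generated by the differences of order one, two, or, for `p = 1`, by those of order
three together with `Δ` (`exists_eq_first_order`, `exists_eq_second_order`, `exists_eq_third_order`).
-/

/-! ### The integral group ring of `ℤ²` and its action on functions -/

/-- The integral group ring of `ℤ²`, with convolution as multiplication. -/
abbrev LatticeRing : Type := AddMonoidAlgebra ℤ (ℤ × ℤ)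

/-- The group element `y` of `ℤ²`, as an element of the group ring. -/
noncomputable def tau (y : ℤ × ℤ) : LatticeRing := AddMonoidAlgebra.single y 1

/-- Translation as a homomorphism from `ℤ²` to the operators on functions. -/
noncomputable def translateHom : Multiplicative (ℤ × ℤ) →* Module.End ℂ (ℤ × ℤ → ℂ) where
  toFun y :=
    { toFun := fun f x => f (x - y.toAdd)
      map_add' := fun _ _ => rfl
      map_smul' := fun _ _ => rfl }
  map_one' := by ext1 f; ext1 x; simp
  map_mul' a b := by
    refine LinearMap.ext fun f => funext fun x => ?_
    change f _ = f _
    congr 1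
    rw [toAdd_mul]
    abel

/-- The action of the group ring on functions by convolution. -/
noncomputable def act : LatticeRing →ₐ[ℤ] Module.End ℂ (ℤ × ℤ → ℂ) :=
  AddMonoidAlgebra.lift ℤ (Module.End ℂ (ℤ × ℤ → ℂ)) (ℤ × ℤ) translateHom

lemma act_single (y : ℤ × ℤ) (c : ℤ) (f : ℤ × ℤ → ℂ) (x : ℤ × ℤ) :
    act (AddMonoidAlgebra.single y c) f x = c * f (x - y) := by
  rw [act, AddMonoidAlgebra.lift_single]
  simp [translateHom]

lemma act_tau (y : ℤ × ℤ) (f : ℤ × ℤ → ℂ) (x : ℤ × ℤ) : act (tau y) f x = f (x - y) := by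
  rw [tau, act_single]; simp

lemma act_tau_eq (y : ℤ × ℤ) (f : ℤ × ℤ → ℂ) : act (tau y) f = translateZ2 y f :=
  funext fun x => act_tau y f x

lemma act_mul (a b : LatticeRing) (f : ℤ × ℤ → ℂ) : act (a * b) f = act a (act b f) := by
  rw [map_mul]; rfl

lemma act_add (a b : LatticeRing) (f : ℤ × ℤ → ℂ) : act (a + b) f = act a f + act b f := by
  rw [map_add]; rfl

lemma act_sub (a b : LatticeRing) (f : ℤ × ℤ → ℂ) : act (a - b) f = act a f - act b f := by
  rw [map_sub]; rfl

lemma act_one (f : ℤ × ℤ → ℂ) : act 1 f = f := by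
  rw [map_one]; rfl

lemma act_intCast (n : ℤ) (f : ℤ × ℤ → ℂ) : act (n : LatticeRing) f = (n : ℂ) • f := by
  rw [map_intCast]
  ext x
  simp

lemma act_comm (a b : LatticeRing) (f : ℤ × ℤ → ℂ) : act a (act b f) = act b (act a f) := by
  rw [← act_mul, mul_comm, act_mul]

lemma tau_mul (y z : ℤ × ℤ) : tau y * tau z = tau (y + z) := by
  simp [tau, AddMonoidAlgebra.single_mul_single]

lemma tau_zero : tau 0 = 1 := rfl

lemma single_eq_mul_tau (y : ℤ × ℤ) (c : ℤ) :
    (AddMonoidAlgebra.single y c : LatticeRing) = (c : LatticeRing) * tau y := by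
  rw [tau, ← zsmul_eq_mul, AddMonoidAlgebra.smul_single]
  simp

/-- Induction principle for the group ring: it is additively generated by the integer multiples of
group elements. -/
lemma latticeRing_induction {P : LatticeRing → Prop} (a : LatticeRing)
    (hadd : ∀ a b, P a → P b → P (a + b)) (hmono : ∀ (c : ℤ) y, P ((c : LatticeRing) * tau y)) :
    P a := by
  refine AddMonoidAlgebra.induction_linear a ?_ hadd ?_
  · simpa using hmono 0 0
  · intro y c
    rw [single_eq_mul_tau]
    exact hmono c y

/-- An element of the group ring, regarded as a finitely supported function. -/
noncomputable def latticeFn (a : LatticeRing) (x : ℤ × ℤ) : ℂ := (a.coeff x : ℂ)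

lemma latticeFn_add (a b : LatticeRing) : latticeFn (a + b) = latticeFn a + latticeFn b := by
  ext x; simp [latticeFn]

lemma coeff_intCast_mul (c : ℤ) (a : LatticeRing) (x : ℤ × ℤ) :
    ((c : LatticeRing) * a).coeff x = c * a.coeff x := by
  rw [← zsmul_eq_mul, AddMonoidAlgebra.coeff_smul_apply, smul_eq_mul]

lemma latticeFn_intCast_mul (c : ℤ) (a : LatticeRing) :
    latticeFn ((c : LatticeRing) * a) = (c : ℂ) • latticeFn a := by
  ext x
  simp [latticeFn, coeff_intCast_mul]

lemma coeff_tau_mul (y : ℤ × ℤ) (a : LatticeRing) (x : ℤ × ℤ) :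
    (tau y * a).coeff x = a.coeff (x - y) := by
  rw [tau, AddMonoidAlgebra.coeff_single_mul_eq_mul_coeff (x - y), one_mul]
  intro z _
  constructor
  · rintro rfl; abel
  · rintro rfl; abel

lemma latticeFn_one : latticeFn 1 = basisZero := by
  ext x
  simp only [latticeFn, basisZero, AddMonoidAlgebra.one_def, AddMonoidAlgebra.coeff_single,
    Finsupp.single_apply]
  by_cases h : x = (0, 0)
  · subst h; simp [Prod.ext_iff]
  · rw [if_neg h, if_neg]
    · simp
    · rintro rfl; exact h rfl

lemma act_latticeFn (a b : LatticeRing) : act a (latticeFn b) = latticeFn (a * b) := by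
  induction a using latticeRing_induction with
  | hadd a a' h h' => rw [act_add, h, h', add_mul, latticeFn_add]
  | hmono c y =>
    rw [act_mul, act_intCast, mul_assoc, latticeFn_intCast_mul]
    congr 1
    ext x
    rw [act_tau, latticeFn, latticeFn, coeff_tau_mul]

lemma act_basisZero (a : LatticeRing) : act a basisZero = latticeFn a := by
  rw [← latticeFn_one, act_latticeFn, mul_one]

lemma tendsto_act {ι : Type*} {l : Filter ι} {F : ι → ℤ × ℤ → ℂ} {f : ℤ × ℤ → ℂ}
    (h : ∀ x, Tendsto (fun n => F n x) l (𝓝 (f x))) (a : LatticeRing) (x : ℤ × ℤ) :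
    Tendsto (fun n => act a (F n) x) l (𝓝 (act a f x)) := by
  induction a using latticeRing_induction with
  | hadd a b ha hb => simpa only [act_add, Pi.add_apply] using ha.add hb
  | hmono c y =>
    simp only [act_mul, act_intCast, Pi.smul_apply, act_tau]
    exact (h _).const_smul _

/-! ### Differences, the Laplacian and the augmentation ideal -/

/-- The group ring element acting as `discD1`. -/
noncomputable def diff1 : LatticeRing := tau (-1, 0) - 1

/-- The group ring element acting as `discD2`. -/
noncomputable def diff2 : LatticeRing := tau (0, -1) - 1

/-- The sum of the four unit steps: `4` times the step distribution of simple random walk. -/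
noncomputable def stepSum : LatticeRing := tau (-1, 0) + tau (1, 0) + tau (0, -1) + tau (0, 1)

/-- The group ring element acting as `graphLaplacian`. -/
noncomputable def lap : LatticeRing := 4 - stepSum

lemma act_diff1 (f : ℤ × ℤ → ℂ) : act diff1 f = discD1 f := by
  ext ⟨i, j⟩
  rw [diff1, act_sub, act_one, Pi.sub_apply, act_tau, discD1]
  simp

lemma act_diff2 (f : ℤ × ℤ → ℂ) : act diff2 f = discD2 f := by
  ext ⟨i, j⟩
  rw [diff2, act_sub, act_one, Pi.sub_apply, act_tau, discD2]
  simp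

lemma act_lap (f : ℤ × ℤ → ℂ) : act lap f = graphLaplacian f := by
  ext ⟨i, j⟩
  have h4 : (4 : LatticeRing) = ((4 : ℤ) : LatticeRing) := by norm_num
  rw [lap, stepSum, act_sub, act_add, act_add, act_add, h4, act_intCast]
  simp only [Pi.sub_apply, Pi.add_apply, act_tau, graphLaplacian, Pi.smul_apply, Prod.mk_sub_mk,
    sub_zero, sub_neg_eq_add, smul_eq_mul, Int.cast_ofNat]
  ring

/-- The augmentation ideal, in the form generated by the two differences. -/
noncomputable def augIdeal : Ideal LatticeRing := Ideal.span {diff1, diff2}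

lemma tau_sub_one_mem (y : ℤ × ℤ) : tau y - 1 ∈ augIdeal := by
  let K : AddSubgroup (ℤ × ℤ) :=
    { carrier := {y | tau y - 1 ∈ augIdeal}
      zero_mem' := by simp [tau_zero]
      add_mem' := by
        intro y z hy hz
        have : tau (y + z) - 1 = tau y * (tau z - 1) + (tau y - 1) := by rw [← tau_mul]; ring
        rw [Set.mem_ofPred_eq, this]
        exact add_mem (Ideal.mul_mem_left _ _ hz) hy
      neg_mem' := by
        intro y hy
        have h1 : tau (-y) * tau y = 1 := by rw [tau_mul, neg_add_cancel, tau_zero]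
        have : tau (-y) - 1 = -tau (-y) * (tau y - 1) := by linear_combination h1
        rw [Set.mem_ofPred_eq, this]
        exact Ideal.mul_mem_left _ _ hy }
  have h1 : ((-1, 0) : ℤ × ℤ) ∈ K := Ideal.subset_span (by simp [diff1])
  have h2 : ((0, -1) : ℤ × ℤ) ∈ K := Ideal.subset_span (by simp [diff2])
  have : y = (-y.1) • ((-1, 0) : ℤ × ℤ) + (-y.2) • ((0, -1) : ℤ × ℤ) := by ext <;> simp
  have hy : y ∈ K := by
    rw [this]
    exact K.add_mem (K.zsmul_mem h1 _) (K.zsmul_mem h2 _)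
  exact hy

/-- Every element of the group ring is an integer plus an element of the augmentation ideal. -/
lemma exists_eq_intCast_add (a : LatticeRing) :
    ∃ (c : ℤ) (b₁ b₂ : LatticeRing), a = c + b₁ * diff1 + b₂ * diff2 := by
  suffices h : ∃ c : ℤ, a - c ∈ augIdeal by
    obtain ⟨c, hc⟩ := h
    obtain ⟨b₁, b₂, h⟩ := Ideal.mem_span_pair.1 hc
    exact ⟨c, b₁, b₂, by linear_combination -h⟩
  induction a using latticeRing_induction with
  | hadd a b ha hb =>
    obtain ⟨c, hc⟩ := ha
    obtain ⟨d, hd⟩ := hb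
    refine ⟨c + d, ?_⟩
    have : a + b - ((c + d : ℤ) : LatticeRing) = (a - c) + (b - d) := by push_cast; ring
    rw [this]
    exact add_mem hc hd
  | hmono c y =>
    refine ⟨c, ?_⟩
    have : (c : LatticeRing) * tau y - c = c * (tau y - 1) := by ring
    rw [this]
    exact Ideal.mul_mem_left _ _ (tau_sub_one_mem y)

lemma act_diff1_const (c : ℂ) : act diff1 (fun _ => c) = 0 := by
  rw [act_diff1]; ext x; simp [discD1]

lemma act_diff2_const (c : ℂ) : act diff2 (fun _ => c) = 0 := by
  rw [act_diff2]; ext x; simp [discD2]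

lemma act_const_of_mem {a : LatticeRing} (ha : a ∈ augIdeal) (c : ℂ) :
    act a (fun _ => c) = 0 := by
  obtain ⟨b₁, b₂, rfl⟩ := Ideal.mem_span_pair.1 ha
  rw [act_add, act_mul, act_mul, act_diff1_const, act_diff2_const]
  simp

lemma diff1_mem : diff1 ∈ augIdeal := Ideal.subset_span (by simp)

lemma diff2_mem : diff2 ∈ augIdeal := Ideal.subset_span (by simp)

lemma lap_mem : lap ∈ augIdeal := by
  have : lap = -((tau (-1, 0) - 1) + (tau (1, 0) - 1) + (tau (0, -1) - 1) + (tau (0, 1) - 1)) := by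
    rw [lap, stepSum]; ring
  rw [this]
  exact neg_mem (add_mem (add_mem (add_mem (tau_sub_one_mem _) (tau_sub_one_mem _))
    (tau_sub_one_mem _)) (tau_sub_one_mem _))

/-- The Laplacian is, up to units, the sum of the two pure second differences. -/
lemma lap_eq : lap = -(tau (1, 0) * diff1 ^ 2 + tau (0, 1) * diff2 ^ 2) := by
  have h1 : tau (1, 0) * tau (-1, 0) = 1 := by rw [tau_mul]; rfl
  have h2 : tau (0, 1) * tau (0, -1) = 1 := by rw [tau_mul]; rfl
  rw [lap, stepSum, diff1, diff2]
  linear_combination (-2 + tau (-1, 0)) * h1 + (-2 + tau (0, -1)) * h2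

/-! ### Mean deviation of the binomial distribution -/

lemma sum_choose_mul_sq (N : ℕ) :
    ∑ k ∈ Finset.range (N + 1), (N.choose k : ℝ) * (2 * (k : ℝ) - N) ^ 2 = (N : ℝ) * 2 ^ N := by
  have h := congrArg (Polynomial.eval (1 / 2 : ℝ)) (bernsteinPolynomial.variance ℝ N)
  rw [Polynomial.eval_finsetSum] at h
  simp only [bernsteinPolynomial, nsmul_eq_mul, Polynomial.eval_mul, Polynomial.eval_pow,
    Polynomial.eval_sub, Polynomial.eval_natCast, Polynomial.eval_X, Polynomial.eval_one] at h
  have h2 : ∀ k ∈ Finset.range (N + 1), (N.choose k : ℝ) * (2 * (k : ℝ) - N) ^ 2 =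
      4 * 2 ^ N * ((N * (1 / 2) - k) ^ 2 *
        (N.choose k * (1 / 2) ^ k * (1 - 1 / 2) ^ (N - k))) := by
    intro k hk
    have hk' : k ≤ N := Nat.lt_succ_iff.1 (Finset.mem_range.1 hk)
    have h3 : (2 : ℝ) ^ N * ((1 / 2) ^ k * (1 - 1 / 2) ^ (N - k)) = 1 := by
      rw [show (1 - 1 / 2 : ℝ) = 1 / 2 by norm_num, ← pow_add, Nat.add_sub_cancel' hk', ← mul_pow]
      norm_num
    linear_combination (-4 * (N * (1 / 2) - k : ℝ) ^ 2 * N.choose k) * h3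
  rw [Finset.sum_congr rfl h2, ← Finset.mul_sum, h]
  ring

/-- Twice the mean absolute deviation of the binomial distribution is at most `√N`. -/
lemma sum_choose_mul_abs_le (N : ℕ) :
    ∑ k ∈ Finset.range (N + 1), (N.choose k : ℝ) * |2 * (k : ℝ) - N| ≤ 2 ^ N * √N := by
  have h := Finset.sum_sq_le_sum_mul_sum_of_sq_le_mul (Finset.range (N + 1))
    (f := fun k => (N.choose k : ℝ)) (g := fun k => (N.choose k : ℝ) * (2 * (k : ℝ) - N) ^ 2)
    (r := fun k => (N.choose k : ℝ) * |2 * (k : ℝ) - N|)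
    (fun k _ => by positivity) (fun k _ => by positivity)
    (fun k _ => by rw [mul_pow, sq_abs]; exact le_of_eq (by ring))
  have h1 : ∑ k ∈ Finset.range (N + 1), (N.choose k : ℝ) = 2 ^ N := by
    exact_mod_cast Nat.sum_range_choose N
  rw [sum_choose_mul_sq, h1] at h
  refine abs_le_of_sq_le_sq' ?_ (by positivity) |>.2
  rw [mul_pow, Real.sq_sqrt (by positivity)]
  calc _ ≤ _ := h
    _ = _ := by ring

/-- Binomial coefficients are partial sums of their own differences, which makes them small. -/
lemma choose_le (n k : ℕ) : (n.choose k : ℝ) ≤ 2 ^ (n + 1) / √(n + 1) := by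
  have key : ∀ k, ((n : ℝ) + 1) * n.choose k =
      ∑ j ∈ Finset.range (k + 1), ((n + 1).choose j : ℝ) * (n + 1 - 2 * j) := by
    intro k
    induction k with
    | zero => simp
    | succ k ih =>
      rw [Finset.sum_range_succ, ← ih]
      have h1 : ((n + 1).choose (k + 1) : ℝ) = n.choose k + n.choose (k + 1) := by
        exact_mod_cast Nat.choose_succ_succ n k
      have h2 : ((n : ℝ) + 1) * n.choose k = (n + 1).choose (k + 1) * (k + 1) := by
        exact_mod_cast Nat.add_one_mul_choose_eq n k
      rw [h1] at h2 ⊢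
      push_cast
      linear_combination (-2) * h2
  have hpos : (0 : ℝ) < √(n + 1) := by positivity
  rcases lt_or_ge n k with hk | hk
  · rw [Nat.choose_eq_zero_of_lt hk, Nat.cast_zero]; positivity
  have h3 : ((n : ℝ) + 1) * n.choose k ≤ 2 ^ (n + 1) * √(n + 1) := by
    rw [key]
    have h4 := sum_choose_mul_abs_le (n + 1)
    push_cast at h4
    refine le_trans ?_ h4
    calc _ ≤ ∑ j ∈ Finset.range (k + 1), ((n + 1).choose j : ℝ) * |2 * (j : ℝ) - (n + 1)| := by
          refine Finset.sum_le_sum fun j _ => mul_le_mul_of_nonneg_left ?_ (by positivity)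
          rw [abs_sub_comm]
          exact le_abs_self _
      _ ≤ _ := Finset.sum_le_sum_of_subset_of_nonneg
          (Finset.range_subset_range.2 (by omega))
          (fun _ _ _ => mul_nonneg (Nat.cast_nonneg _) (abs_nonneg _))
  rw [le_div_iff₀ hpos]
  have h5 : √((n : ℝ) + 1) * √(n + 1) = n + 1 := Real.mul_self_sqrt (by positivity)
  refine le_of_mul_le_mul_right ?_ hpos
  calc _ = ((n : ℝ) + 1) * n.choose k := by rw [mul_assoc, h5]; ring
    _ ≤ _ := h3

lemma sub_one_mul_one_add_pow {R : Type*} [CommRing R] (u : R) (n : ℕ) :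
    ((n + 1 : ℤ) : R) * ((u - 1) * (1 + u) ^ n) = ∑ k ∈ Finset.range (n + 2),
      (((n + 1).choose k * (2 * k - (n + 1)) : ℤ) : R) * u ^ k := by
  have hp : ((Polynomial.X + 1 : Polynomial ℤ)) ^ (n + 1) =
      ∑ k ∈ Finset.range (n + 2), Polynomial.C ((n + 1).choose k : ℤ) * Polynomial.X ^ k := by
    rw [add_pow]
    refine Finset.sum_congr rfl fun k _ => ?_
    simp [mul_comm]
  have hd := congrArg (fun p => Polynomial.aeval u (Polynomial.X * Polynomial.derivative p)) hp
  have he := congrArg (Polynomial.aeval u) hp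
  simp only [map_sum, map_mul, map_pow, Polynomial.aeval_X,
    Polynomial.derivative_X, Polynomial.derivative_one,
    Polynomial.derivative_pow, Polynomial.derivative_mul, map_add,
    map_one, zero_mul, zero_add, add_zero, mul_one,
    Polynomial.derivative_natCast, map_natCast, Finset.mul_sum,
    Nat.add_sub_cancel] at hd he
  have hs : ∀ k : ℕ, (((n + 1).choose k * (2 * k - (n + 1)) : ℤ) : R) * u ^ k =
      2 * (u * (((n + 1).choose k : R) * ((k : R) * u ^ (k - 1)))) -
      ((n : R) + 1) * (((n + 1).choose k : R) * u ^ k) := by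
    intro k
    rcases k with _ | k
    · push_cast; ring
    · rw [Nat.add_sub_cancel]; push_cast; ring
  simp only [hs, Finset.sum_sub_distrib, ← Finset.mul_sum]
  simp only [← Finset.mul_sum] at hd
  rw [← he, ← hd]
  push_cast
  ring

/-! ### The `ℓ¹` norm on the group ring -/

/-- The `ℓ¹` norm of an element of the group ring. -/
noncomputable def l1Norm (a : LatticeRing) : ℝ := ∑' x, |(a.coeff x : ℝ)|

lemma summable_abs_coeff (a : LatticeRing) : Summable fun x => |(a.coeff x : ℝ)| := by
  refine summable_of_hasFiniteSupport (a.coeff.support.finite_toSet.subset ?_)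
  intro x hx
  simpa using hx

lemma l1Norm_nonneg (a : LatticeRing) : 0 ≤ l1Norm a := tsum_nonneg fun _ => abs_nonneg _

lemma l1Norm_add_le (a b : LatticeRing) : l1Norm (a + b) ≤ l1Norm a + l1Norm b := by
  rw [l1Norm, l1Norm, l1Norm, ← (summable_abs_coeff a).tsum_add (summable_abs_coeff b)]
  refine (summable_abs_coeff _).tsum_le_tsum (fun x => ?_)
    ((summable_abs_coeff a).add (summable_abs_coeff b))
  rw [AddMonoidAlgebra.coeff_add, Finsupp.add_apply, Int.cast_add]
  exact abs_add_le _ _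

lemma l1Norm_zero : l1Norm 0 = 0 := by simp [l1Norm]

lemma l1Norm_sum_le {ι : Type*} (s : Finset ι) (f : ι → LatticeRing) :
    l1Norm (∑ i ∈ s, f i) ≤ ∑ i ∈ s, l1Norm (f i) :=
  Finset.le_sum_of_subadditive _ l1Norm_zero.le l1Norm_add_le _ _

lemma l1Norm_intCast_mul (c : ℤ) (a : LatticeRing) :
    l1Norm ((c : LatticeRing) * a) = |(c : ℝ)| * l1Norm a := by
  simp [l1Norm, coeff_intCast_mul, abs_mul, tsum_mul_left]

lemma l1Norm_tau_mul (y : ℤ × ℤ) (a : LatticeRing) : l1Norm (tau y * a) = l1Norm a := by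
  simp only [l1Norm, coeff_tau_mul]
  exact (Equiv.subRight y).tsum_eq fun x => |(a.coeff x : ℝ)|

lemma l1Norm_one : l1Norm 1 = 1 := by
  rw [l1Norm, tsum_eq_single 0]
  · simp [AddMonoidAlgebra.one_def]
  · intro x hx
    simp [AddMonoidAlgebra.one_def, hx.symm]

lemma l1Norm_tau (y : ℤ × ℤ) : l1Norm (tau y) = 1 := by
  rw [← mul_one (tau y), l1Norm_tau_mul, l1Norm_one]

lemma eq_sum_tau (a : LatticeRing) :
    a = ∑ y ∈ a.coeff.support, ((a.coeff y : ℤ) : LatticeRing) * tau y := by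
  conv_lhs => rw [← AddMonoidAlgebra.sum_coeff_single a]
  exact Finset.sum_congr rfl fun y _ => single_eq_mul_tau _ _

lemma l1Norm_eq_sum (a : LatticeRing) :
    l1Norm a = ∑ y ∈ a.coeff.support, |(a.coeff y : ℝ)| := by
  refine tsum_eq_sum fun x hx => ?_
  simpa using hx

lemma l1Norm_mul_le (a b : LatticeRing) : l1Norm (a * b) ≤ l1Norm a * l1Norm b := by
  conv_lhs => rw [eq_sum_tau a, Finset.sum_mul]
  refine (l1Norm_sum_le _ _).trans_eq ?_
  simp only [mul_assoc, l1Norm_intCast_mul, l1Norm_tau_mul]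
  rw [← Finset.sum_mul, ← l1Norm_eq_sum]

lemma abs_coeff_mul_le (a : LatticeRing) {b : LatticeRing} {M : ℝ}
    (hb : ∀ x, |(b.coeff x : ℝ)| ≤ M) (x : ℤ × ℤ) :
    |((a * b).coeff x : ℝ)| ≤ l1Norm a * M := by
  conv_lhs => rw [eq_sum_tau a, Finset.sum_mul]
  rw [AddMonoidAlgebra.coeff_sum, Finsupp.finsetSum_apply, Int.cast_sum, l1Norm_eq_sum,
    Finset.sum_mul]
  refine (Finset.abs_sum_le_sum_abs _ _).trans (Finset.sum_le_sum fun y _ => ?_)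
  rw [mul_assoc, coeff_intCast_mul, coeff_tau_mul, Int.cast_mul, abs_mul]
  exact mul_le_mul_of_nonneg_left (hb _) (abs_nonneg _)

lemma l1Norm_pow_le (a : LatticeRing) (n : ℕ) : l1Norm (a ^ n) ≤ l1Norm a ^ n := by
  induction n with
  | zero => simp [l1Norm_one]
  | succ n ih =>
    rw [pow_succ, pow_succ]
    exact (l1Norm_mul_le _ _).trans (mul_le_mul_of_nonneg_right ih (l1Norm_nonneg _))

lemma l1Norm_one_add_tau_pow_le (y : ℤ × ℤ) (n : ℕ) : l1Norm ((1 + tau y) ^ n) ≤ 2 ^ n := by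
  refine (l1Norm_pow_le _ n).trans (pow_le_pow_left₀ (l1Norm_nonneg _) ?_ n)
  refine (l1Norm_add_le _ _).trans_eq ?_
  rw [l1Norm_one, l1Norm_tau]
  norm_num

lemma tau_pow (y : ℤ × ℤ) (k : ℕ) : tau y ^ k = tau (k • y) := by
  simp [tau, AddMonoidAlgebra.single_pow]

lemma l1Norm_sub_one_mul_pow_le (y : ℤ × ℤ) (n : ℕ) :
    l1Norm ((tau y - 1) * (1 + tau y) ^ n) ≤ 2 ^ (n + 1) / √(n + 1) := by
  have h : ((n : ℝ) + 1) * l1Norm ((tau y - 1) * (1 + tau y) ^ n) ≤ 2 ^ (n + 1) * √(n + 1) := by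
    have h1 := l1Norm_intCast_mul (n + 1 : ℤ) ((tau y - 1) * (1 + tau y) ^ n)
    rw [sub_one_mul_one_add_pow] at h1
    have h2 : |(((n + 1 : ℤ)) : ℝ)| = n + 1 := by
      push_cast
      exact abs_of_nonneg (by positivity)
    rw [h2] at h1
    rw [← h1]
    have h4 := sum_choose_mul_abs_le (n + 1)
    push_cast at h4
    refine (l1Norm_sum_le _ _).trans (le_trans (le_of_eq ?_) h4)
    refine Finset.sum_congr rfl fun k _ => ?_
    rw [tau_pow, l1Norm_intCast_mul, l1Norm_tau]
    push_cast
    rw [mul_one, abs_mul, abs_of_nonneg (by positivity : (0 : ℝ) ≤ ((n + 1).choose k : ℝ))]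
  have hpos : (0 : ℝ) < √(n + 1) := by positivity
  have h5 : √((n : ℝ) + 1) * √(n + 1) = n + 1 := Real.mul_self_sqrt (by positivity)
  rw [le_div_iff₀ hpos]
  refine le_of_mul_le_mul_right ?_ hpos
  calc _ = ((n : ℝ) + 1) * l1Norm ((tau y - 1) * (1 + tau y) ^ n) := by rw [mul_assoc, h5]; ring
    _ ≤ _ := h

/-! ### Decay of the powers of the random walk step -/

/-- In the diagonal directions the simple random walk is a product of two walks on `ℤ`. -/
lemma stepSum_eq : stepSum = tau (-1, 0) * ((1 + tau (1, 1)) * (1 + tau (1, -1))) := by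
  have h1 : tau (-1, 0) * tau (1, 1) = tau (0, 1) := by rw [tau_mul]; rfl
  have h2 : tau (-1, 0) * tau (1, -1) = tau (0, -1) := by rw [tau_mul]; rfl
  have h3 : tau (0, 1) * tau (1, -1) = tau (1, 0) := by rw [tau_mul]; rfl
  rw [stepSum]
  linear_combination (-1 - tau (1, -1)) * h1 - h2 - h3

lemma stepSum_pow (n : ℕ) : stepSum ^ n =
    tau (n • (-1, 0)) * ((1 + tau (1, 1)) ^ n * (1 + tau (1, -1)) ^ n) := by
  rw [stepSum_eq, mul_pow, mul_pow, tau_pow]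

lemma l1Norm_stepSum_pow_le (n : ℕ) : l1Norm (stepSum ^ n) ≤ 4 ^ n := by
  rw [stepSum_pow, l1Norm_tau_mul, show (4 : ℝ) = 2 * 2 by norm_num, mul_pow]
  exact (l1Norm_mul_le _ _).trans (mul_le_mul (l1Norm_one_add_tau_pow_le _ _)
    (l1Norm_one_add_tau_pow_le _ _) (l1Norm_nonneg _) (by positivity))

lemma coeff_one_add_tau_pow_mul (y : ℤ × ℤ) (n : ℕ) (b : LatticeRing) (x : ℤ × ℤ) :
    ((1 + tau y) ^ n * b).coeff x =
      ∑ k ∈ Finset.range (n + 1), (n.choose k : ℤ) * b.coeff (x - k • y) := by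
  rw [add_comm, add_pow, Finset.sum_mul, AddMonoidAlgebra.coeff_sum, Finsupp.finsetSum_apply]
  refine Finset.sum_congr rfl fun k _ => ?_
  rw [one_pow, mul_one, tau_pow, mul_comm (tau _), mul_assoc, ← Int.cast_natCast,
    coeff_intCast_mul, coeff_tau_mul]

/-- The `n`-step distribution of the walk is bounded by `4 / (n + 1)`: a site is reached by at most
one pair of values of the two independent diagonal walks. -/
lemma abs_coeff_stepSum_pow_le (n : ℕ) (x : ℤ × ℤ) :
    |((stepSum ^ n).coeff x : ℝ)| ≤ 4 * 4 ^ n * (n + 1 : ℝ) ^ (-1 : ℝ) := by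
  rw [stepSum_pow, coeff_tau_mul]
  generalize x - n • (-1, 0) = x
  set M : ℝ := 2 ^ (n + 1) / √(n + 1) with hM
  have hM0 : 0 ≤ M := by positivity
  have hMM : M * M = 4 * 4 ^ n * (n + 1 : ℝ) ^ (-1 : ℝ) := by
    rw [hM, div_mul_div_comm, Real.mul_self_sqrt (by positivity), Real.rpow_neg_one,
      ← mul_pow, pow_succ, div_eq_mul_inv, show (2 * 2 : ℝ) = 4 by norm_num]
    ring
  rw [← hMM, ← mul_one ((1 + tau (1, -1)) ^ n)]
  rw [coeff_one_add_tau_pow_mul]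
  simp only [coeff_one_add_tau_pow_mul, Finset.mul_sum]
  simp only [AddMonoidAlgebra.one_def, AddMonoidAlgebra.coeff_single, Finsupp.single_apply]
  rw [← Finset.sum_product']
  push_cast
  refine (Finset.abs_sum_le_sum_abs _ _).trans ?_
  calc _ ≤ ∑ p ∈ Finset.range (n + 1) ×ˢ Finset.range (n + 1),
        if (0 : ℤ × ℤ) = x - p.1 • (1, 1) - p.2 • (1, -1) then M * M else 0 := by
        refine Finset.sum_le_sum fun p _ => ?_
        split_ifs
        · rw [abs_mul, abs_mul, Nat.abs_cast, Nat.abs_cast, abs_one, mul_one]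
          exact mul_le_mul (choose_le _ _) (choose_le _ _) (by positivity) hM0
        · simp
    _ = ((Finset.range (n + 1) ×ˢ Finset.range (n + 1)).filter
          fun p => (0 : ℤ × ℤ) = x - p.1 • (1, 1) - p.2 • (1, -1)).card • (M * M) := by
        rw [← Finset.sum_filter, Finset.sum_const]
    _ ≤ 1 • (M * M) := by
        refine nsmul_le_nsmul_left (by positivity) ?_
        refine Finset.card_le_one.2 fun p hp q hq => ?_
        have h1 := (Finset.mem_filter.1 hp).2
        have h2 := (Finset.mem_filter.1 hq).2
        simp only [Prod.ext_iff, Prod.fst_sub, Prod.snd_sub, Prod.smul_mk, Prod.fst_zero,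
          Prod.snd_zero, nsmul_eq_mul] at h1 h2
        ext <;> omega
    _ = M * M := one_nsmul _

/-- `a` applied to the `n`-step distribution of the random walk has `ℓ¹` norm `O(n ^ (-α))`. -/
def L1Decay (a : LatticeRing) (α : ℝ) : Prop :=
  ∃ C : ℝ, ∀ n : ℕ, l1Norm (a * stepSum ^ n) ≤ C * 4 ^ n * (n + 1 : ℝ) ^ (-α)

/-- `a` applied to the `n`-step distribution of the random walk has sup norm `O(n ^ (-β))`. -/
def SupDecay (a : LatticeRing) (β : ℝ) : Prop :=
  ∃ C : ℝ, ∀ (n : ℕ) (x : ℤ × ℤ), |((a * stepSum ^ n).coeff x : ℝ)| ≤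
    C * 4 ^ n * (n + 1 : ℝ) ^ (-β)

lemma L1Decay.add {a b : LatticeRing} {α : ℝ} (ha : L1Decay a α) (hb : L1Decay b α) :
    L1Decay (a + b) α := by
  obtain ⟨C, hC⟩ := ha
  obtain ⟨D, hD⟩ := hb
  refine ⟨C + D, fun n => ?_⟩
  rw [add_mul]
  refine (l1Norm_add_le _ _).trans ((add_le_add (hC n) (hD n)).trans_eq ?_)
  ring

lemma L1Decay.mul_left {a : LatticeRing} {α : ℝ} (ha : L1Decay a α) (c : LatticeRing) :
    L1Decay (c * a) α := by
  obtain ⟨C, hC⟩ := ha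
  refine ⟨l1Norm c * C, fun n => ?_⟩
  rw [mul_assoc]
  refine (l1Norm_mul_le _ _).trans
    ((mul_le_mul_of_nonneg_left (hC n) (l1Norm_nonneg c)).trans_eq ?_)
  ring

lemma SupDecay.add {a b : LatticeRing} {β : ℝ} (ha : SupDecay a β) (hb : SupDecay b β) :
    SupDecay (a + b) β := by
  obtain ⟨C, hC⟩ := ha
  obtain ⟨D, hD⟩ := hb
  refine ⟨C + D, fun n x => ?_⟩
  rw [add_mul, AddMonoidAlgebra.coeff_add, Finsupp.add_apply, Int.cast_add]
  refine (abs_add_le _ _).trans ((add_le_add (hC n x) (hD n x)).trans_eq ?_)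
  ring

lemma SupDecay.mul_left {a : LatticeRing} {β : ℝ} (ha : SupDecay a β) (c : LatticeRing) :
    SupDecay (c * a) β := by
  obtain ⟨C, hC⟩ := ha
  refine ⟨l1Norm c * C, fun n x => ?_⟩
  rw [mul_assoc]
  refine (abs_coeff_mul_le c (hC n) x).trans_eq ?_
  ring

lemma rpow_neg_le_of_le_two_mul {α : ℝ} (hα : 0 ≤ α) {m n : ℕ} (h : n + 1 ≤ 2 * (m + 1)) :
    (m + 1 : ℝ) ^ (-α) ≤ 2 ^ α * (n + 1 : ℝ) ^ (-α) := by
  have h1 : ((n : ℝ) + 1) / 2 ≤ m + 1 := by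
    rw [div_le_iff₀ (by norm_num)]
    have : ((n + 1 : ℕ) : ℝ) ≤ ((2 * (m + 1) : ℕ) : ℝ) := by exact_mod_cast h
    push_cast at this
    linarith
  refine (Real.rpow_le_rpow_of_nonpos (by positivity) h1 (by linarith)).trans_eq ?_
  rw [Real.div_rpow (by positivity) (by norm_num), Real.rpow_neg (by norm_num : (0 : ℝ) ≤ 2)]
  field_simp

/-- The factor used to split `n` steps of the walk into two halves. -/
lemma mul_halves_le {α β : ℝ} (hα : 0 ≤ α) (hβ : 0 ≤ β) {C D : ℝ} (hC : 0 ≤ C) (hD : 0 ≤ D)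
    (n : ℕ) :
    (C * 4 ^ (n / 2) * ((n / 2 : ℕ) + 1 : ℝ) ^ (-α)) *
      (D * 4 ^ (n - n / 2) * ((n - n / 2 : ℕ) + 1 : ℝ) ^ (-β)) ≤
    C * D * 2 ^ α * 2 ^ β * 4 ^ n * (n + 1 : ℝ) ^ (-(α + β)) := by
  have h1 := rpow_neg_le_of_le_two_mul hα (show n + 1 ≤ 2 * (n / 2 + 1) by omega)
  have h2 := rpow_neg_le_of_le_two_mul hβ (show n + 1 ≤ 2 * (n - n / 2 + 1) by omega)
  have h3 : (4 : ℝ) ^ n = 4 ^ (n / 2) * 4 ^ (n - n / 2) := by rw [← pow_add]; congr 1; omega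
  rw [neg_add, Real.rpow_add (by positivity), h3]
  calc _ ≤ (C * 4 ^ (n / 2) * (2 ^ α * (n + 1 : ℝ) ^ (-α))) *
      (D * 4 ^ (n - n / 2) * (2 ^ β * (n + 1 : ℝ) ^ (-β))) := by gcongr
    _ = _ := by ring

lemma mul_mul_stepSum_pow (a b : LatticeRing) (n : ℕ) :
    a * b * stepSum ^ n = (a * stepSum ^ (n / 2)) * (b * stepSum ^ (n - n / 2)) := by
  have : stepSum ^ n = stepSum ^ (n / 2) * stepSum ^ (n - n / 2) := by
    rw [← pow_add]; congr 1; omega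
  rw [this]
  ring

lemma L1Decay.const_nonneg {a : LatticeRing} {α C : ℝ}
    (h : ∀ n : ℕ, l1Norm (a * stepSum ^ n) ≤ C * 4 ^ n * (n + 1 : ℝ) ^ (-α)) : 0 ≤ C := by
  simpa using (l1Norm_nonneg _).trans (h 0)

lemma SupDecay.const_nonneg {a : LatticeRing} {α C : ℝ}
    (h : ∀ (n : ℕ) (x : ℤ × ℤ), |((a * stepSum ^ n).coeff x : ℝ)| ≤
      C * 4 ^ n * (n + 1 : ℝ) ^ (-α)) : 0 ≤ C := by
  simpa using (abs_nonneg _).trans (h 0 0)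

lemma L1Decay.mul {a b : LatticeRing} {α β : ℝ} (hα : 0 ≤ α) (hβ : 0 ≤ β) (ha : L1Decay a α)
    (hb : L1Decay b β) : L1Decay (a * b) (α + β) := by
  obtain ⟨C, hC⟩ := ha
  obtain ⟨D, hD⟩ := hb
  have hC0 := L1Decay.const_nonneg hC
  refine ⟨C * D * 2 ^ α * 2 ^ β, fun n => ?_⟩
  rw [mul_mul_stepSum_pow]
  exact (l1Norm_mul_le _ _).trans ((mul_le_mul (hC _) (hD _) (l1Norm_nonneg _)
    (by positivity)).trans (mul_halves_le hα hβ hC0 (L1Decay.const_nonneg hD) n))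

lemma SupDecay.mul {a b : LatticeRing} {α β : ℝ} (hα : 0 ≤ α) (hβ : 0 ≤ β) (ha : L1Decay a α)
    (hb : SupDecay b β) : SupDecay (a * b) (α + β) := by
  obtain ⟨C, hC⟩ := ha
  obtain ⟨D, hD⟩ := hb
  have hC0 := L1Decay.const_nonneg hC
  have hD0 := SupDecay.const_nonneg hD
  refine ⟨C * D * 2 ^ α * 2 ^ β, fun n x => ?_⟩
  rw [mul_mul_stepSum_pow]
  exact (abs_coeff_mul_le _ (hD _) x).trans ((mul_le_mul_of_nonneg_right (hC _)
    (by positivity)).trans (mul_halves_le hα hβ hC0 hD0 n))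

lemma supDecay_one : SupDecay 1 1 := by
  refine ⟨4, fun n x => ?_⟩
  rw [one_mul]
  exact abs_coeff_stepSum_pow_le n x

lemma two_pow_div_sqrt_mul (n : ℕ) :
    (2 : ℝ) ^ (n + 1) / √(n + 1) * 2 ^ n = 2 * 4 ^ n * (n + 1 : ℝ) ^ (-(1 / 2) : ℝ) := by
  rw [Real.rpow_neg (by positivity), ← Real.sqrt_eq_rpow, show (4 : ℝ) = 2 * 2 by norm_num,
    mul_pow, pow_succ]
  ring

/-- A diagonal step moves only one of the two independent walks on `ℤ`, and preserves parity: the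
corresponding difference gains a factor `n ^ (-1/2)`. -/
lemma l1Decay_diagonal :
    L1Decay (tau (1, 1) - 1) (1 / 2) ∧ L1Decay (tau (1, -1) - 1) (1 / 2) := by
  constructor
  · refine ⟨2, fun n => ?_⟩
    rw [stepSum_pow, ← two_pow_div_sqrt_mul]
    have : (tau (1, 1) - 1) * (tau (n • (-1, 0)) *
        ((1 + tau (1, 1)) ^ n * (1 + tau (1, -1)) ^ n)) =
        tau (n • (-1, 0)) * (((tau (1, 1) - 1) * (1 + tau (1, 1)) ^ n) *
          (1 + tau (1, -1)) ^ n) := by ring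
    rw [this, l1Norm_tau_mul]
    exact (l1Norm_mul_le _ _).trans (mul_le_mul (l1Norm_sub_one_mul_pow_le _ _)
      (l1Norm_one_add_tau_pow_le _ _) (l1Norm_nonneg _) (by positivity))
  · refine ⟨2, fun n => ?_⟩
    rw [stepSum_pow, ← two_pow_div_sqrt_mul]
    have : (tau (1, -1) - 1) * (tau (n • (-1, 0)) *
        ((1 + tau (1, 1)) ^ n * (1 + tau (1, -1)) ^ n)) =
        tau (n • (-1, 0)) * (((tau (1, -1) - 1) * (1 + tau (1, -1)) ^ n) *
          (1 + tau (1, 1)) ^ n) := by ring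
    rw [this, l1Norm_tau_mul]
    exact (l1Norm_mul_le _ _).trans (mul_le_mul (l1Norm_sub_one_mul_pow_le _ _)
      (l1Norm_one_add_tau_pow_le _ _) (l1Norm_nonneg _) (by positivity))

/-- A single difference changes the parity of a site, so it does not decay on its own. The factor
`4 + stepSum`, which averages two consecutive steps of the walk, repairs this. -/
lemma l1Decay_diff : L1Decay (diff1 * (4 + stepSum)) (1 / 2) ∧
    L1Decay (diff2 * (4 + stepSum)) (1 / 2) := by
  obtain ⟨hs, ht⟩ := l1Decay_diagonal
  set s := tau (1, 1) with hs'
  set t := tau (1, -1) with ht'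
  set X := tau (-1, 0) with hX
  have hXX : X * X * (s * t) = 1 := by rw [hX, hs', ht', tau_mul, tau_mul, tau_mul]; rfl
  have hY : tau (0, -1) = X * t := by rw [hX, ht', tau_mul]; rfl
  have hS : stepSum = X * ((1 + s) * (1 + t)) := stepSum_eq
  constructor
  · have : diff1 * (4 + stepSum) =
        (-X * (1 + t) + X * X * (1 - 3 * t)) * (s - 1) +
          (-2 * X - 2 * X * X) * (t - 1) := by
      rw [diff1, hS, ← hX]
      linear_combination (4 : LatticeRing) * hXX
    rw [this]
    exact (hs.mul_left _).add (ht.mul_left _)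
  · have : diff2 * (4 + stepSum) =
        (-X * (1 + t) + X * X * t * (t - 3)) * (s - 1) +
          (2 * X * X * t + 2 * X) * (t - 1) := by
      rw [diff2, hS, hY]
      linear_combination (4 : LatticeRing) * hXX
    rw [this]
    exact (hs.mul_left _).add (ht.mul_left _)

/-! ### The Green's function -/

lemma coeff_srwStep_pow (n : ℕ) (x : ℤ × ℤ) :
    (srwStep ^ n).coeff x = ((stepSum ^ n).coeff x : ℝ) / 4 ^ n := by
  have h : srwStep = (1 / 4 : ℝ) • AddMonoidAlgebra.mapRingHom (ℤ × ℤ) (Int.castRingHom ℝ)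
      stepSum := by
    ext x
    simp [srwStep, stepSum, tau, Finsupp.single_apply]
  rw [h, smul_pow, ← map_pow, AddMonoidAlgebra.coeff_smul_apply,
    AddMonoidAlgebra.coeff_mapRingHom]
  simp [div_eq_inv_mul]

lemma summable_rpow_neg {β : ℝ} (hβ : 1 < β) : Summable fun n : ℕ => ((n : ℝ) + 1) ^ (-β) := by
  have h := (summable_nat_add_iff 1).2 (Real.summable_nat_rpow (p := -β) |>.2 (by linarith))
  simpa using h

lemma tendsto_rpow_neg {β : ℝ} (hβ : 0 < β) :
    Tendsto (fun n : ℕ => ((n : ℝ) + 1) ^ (-β)) atTop (𝓝 0) :=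
  (tendsto_rpow_neg_atTop hβ).comp
    (tendsto_atTop_add_const_right _ _ tendsto_natCast_atTop_atTop)

/-- The value at `x` of `a` applied to the `n`-step distribution of the random walk. -/
noncomputable def heat (a : LatticeRing) (n : ℕ) (x : ℤ × ℤ) : ℝ :=
  ((a * stepSum ^ n).coeff x : ℝ) / 4 ^ n

lemma SupDecay.exists_abs_heat_le {a : LatticeRing} {β : ℝ} (h : SupDecay a β) :
    ∃ C, ∀ n x, |heat a n x| ≤ C * (n + 1 : ℝ) ^ (-β) := by
  obtain ⟨C, hC⟩ := h
  refine ⟨C, fun n x => ?_⟩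
  rw [heat, abs_div, abs_of_nonneg (by positivity : (0 : ℝ) ≤ 4 ^ n), div_le_iff₀ (by positivity)]
  exact (hC n x).trans_eq (by ring)

lemma SupDecay.summable_heat {a : LatticeRing} {β : ℝ} (h : SupDecay a β) (hβ : 1 < β)
    (x : ℤ × ℤ) : Summable fun n => heat a n x := by
  obtain ⟨C, hC⟩ := h.exists_abs_heat_le
  exact Summable.of_norm_bounded ((summable_rpow_neg hβ).mul_left C) fun n => hC n x

lemma SupDecay.tendsto_heat {a : LatticeRing} {β : ℝ} (h : SupDecay a β) (hβ : 0 < β)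
    (x : ℤ × ℤ) : Tendsto (fun n => heat a n x) atTop (𝓝 0) := by
  obtain ⟨C, hC⟩ := h.exists_abs_heat_le
  refine squeeze_zero_norm (fun n => hC n x) ?_
  simpa using (tendsto_rpow_neg hβ).const_mul C

/-- A series whose terms tend to zero converges if it does so after adding up neighbouring terms. -/
lemma exists_tendsto_of_summable_add_succ {e : ℕ → ℝ} (he : Tendsto e atTop (𝓝 0))
    (hs : Summable fun n => e n + e (n + 1)) :
    ∃ g, Tendsto (fun N => ∑ n ∈ Finset.range N, e n) atTop (𝓝 g) := by
  have h1 := hs.hasSum.tendsto_sum_nat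
  have h2 : ∀ N, ∑ n ∈ Finset.range N, e n =
      (∑ n ∈ Finset.range N, (e n + e (n + 1)) + e 0 - e N) / 2 := by
    intro N
    have h3 := Finset.sum_range_succ e N
    rw [Finset.sum_range_succ'] at h3
    rw [Finset.sum_add_distrib]
    linarith
  exact ⟨_, (((h1.add_const (e 0)).sub he).div_const 2).congr fun N => (h2 N).symm⟩

/-- `HasDecay m k`: smoothed by `(4 + stepSum) ^ k`, the operator `m` applied to the heat kernel
decays like a derivative of order `k`. -/
def HasDecay (m : LatticeRing) (k : ℕ) : Prop :=
  L1Decay (m * (4 + stepSum) ^ k) (k / 2) ∧ SupDecay (m * (4 + stepSum) ^ k) (1 + k / 2)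

lemma hasDecay_of_l1Decay {m : LatticeRing} {k : ℕ}
    (h : L1Decay (m * (4 + stepSum) ^ k) (k / 2)) : HasDecay m k := by
  refine ⟨h, ?_⟩
  have := SupDecay.mul (by positivity) zero_le_one h supDecay_one
  rwa [mul_one, add_comm (k / 2 : ℝ)] at this

lemma hasDecay_diff1 : HasDecay diff1 1 :=
  hasDecay_of_l1Decay (by simpa using l1Decay_diff.1)

lemma hasDecay_diff2 : HasDecay diff2 1 :=
  hasDecay_of_l1Decay (by simpa using l1Decay_diff.2)

lemma HasDecay.mul {a b : LatticeRing} {k l : ℕ} (ha : HasDecay a k) (hb : HasDecay b l) :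
    HasDecay (a * b) (k + l) := by
  refine hasDecay_of_l1Decay ?_
  have := ha.1.mul (by positivity) (by positivity) hb.1
  rw [show a * b * (4 + stepSum) ^ (k + l) =
    a * (4 + stepSum) ^ k * (b * (4 + stepSum) ^ l) by rw [pow_add]; ring]
  convert this using 1
  push_cast
  ring

lemma supDecay_of_mem {a : LatticeRing} (ha : a ∈ augIdeal) :
    SupDecay (a * (4 + stepSum)) (1 + 1 / 2) := by
  obtain ⟨b₁, b₂, rfl⟩ := Ideal.mem_span_pair.1 ha
  have h1 := hasDecay_diff1.2
  have h2 := hasDecay_diff2.2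
  rw [pow_one, Nat.cast_one] at h1 h2
  rw [add_mul, mul_assoc, mul_assoc]
  exact (h1.mul_left b₁).add (h2.mul_left b₂)

lemma greenPartialSum_eq (N : ℕ) (x : ℤ × ℤ) :
    greenPartialSum N x = 1 / 4 * ∑ n ∈ Finset.range N, heat (tau (-x) - 1) n 0 := by
  rw [greenPartialSum]
  congr 1
  refine Finset.sum_congr rfl fun n _ => ?_
  rw [coeff_srwStep_pow, coeff_srwStep_pow, heat, sub_mul, one_mul, AddMonoidAlgebra.coeff_sub,
    Finsupp.sub_apply, coeff_tau_mul, zero_sub, neg_neg, Int.cast_sub, sub_div]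
  rfl

/-- The series defining the Green's function converges: its terms tend to zero, and the sums of two
consecutive terms are of order `n ^ (-3/2)`. -/
lemma exists_tendsto_greenPartialSum (x : ℤ × ℤ) :
    ∃ g : ℝ, Tendsto (fun N => greenPartialSum N x) atTop (𝓝 g) := by
  simp only [greenPartialSum_eq]
  have h1 : Tendsto (fun n => heat (tau (-x) - 1) n 0) atTop (𝓝 0) := by
    have : SupDecay (tau (-x) - 1) 1 := by simpa using supDecay_one.mul_left (tau (-x) - 1)
    exact this.tendsto_heat one_pos 0
  have h2 : Summable fun n => heat (tau (-x) - 1) n 0 + heat (tau (-x) - 1) (n + 1) 0 := by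
    refine (((supDecay_of_mem (tau_sub_one_mem (-x))).summable_heat (by norm_num) 0).mul_left
      (1 / 4)).congr fun n => ?_
    have h4 : (4 : LatticeRing) = ((4 : ℤ) : LatticeRing) := by norm_num
    rw [heat, heat, heat, show (tau (-x) - 1) * (4 + stepSum) * stepSum ^ n =
      4 * ((tau (-x) - 1) * stepSum ^ n) + (tau (-x) - 1) * stepSum ^ (n + 1) by
        rw [pow_succ]; ring, AddMonoidAlgebra.coeff_add, Finsupp.add_apply, h4, coeff_intCast_mul]
    push_cast
    field_simp
    ring
  obtain ⟨g, hg⟩ := exists_tendsto_of_summable_add_succ h1 h2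
  exact ⟨_, hg.const_mul _⟩

lemma greenZ2_spec (x : ℤ × ℤ) :
    ∃ g : ℝ, greenZ2 x = (g : ℂ) ∧ Tendsto (fun N => greenPartialSum N x) atTop (𝓝 g) := by
  obtain ⟨g, hg⟩ := exists_tendsto_greenPartialSum x
  exact ⟨g, by rw [greenZ2, hg.limUnder_eq], hg⟩

lemma tendsto_greenZ2 (x : ℤ × ℤ) :
    Tendsto (fun N => (greenPartialSum N x : ℂ)) atTop (𝓝 (greenZ2 x)) := by
  obtain ⟨g, h, hg⟩ := greenZ2_spec x
  rw [h]
  exact (Complex.continuous_ofReal.tendsto g).comp hg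

/-- An element of the augmentation ideal removes the normalising constant from the partial sums. -/
lemma act_greenPartialSum {d : LatticeRing} (hd : d ∈ augIdeal) (N : ℕ) (x : ℤ × ℤ) :
    act d (fun y => (greenPartialSum N y : ℂ)) x =
      (1 / 4 : ℂ) * ∑ n ∈ Finset.range N, (heat d n x : ℂ) := by
  have h : (fun y => (greenPartialSum N y : ℂ)) =
      (∑ n ∈ Finset.range N, ((1 / 4 * (4 ^ n)⁻¹ : ℂ)) • latticeFn (stepSum ^ n)) -
        fun _ => (1 / 4 * ∑ n ∈ Finset.range N, ((srwStep ^ n).coeff (0, 0) : ℂ)) := by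
    ext y
    rw [greenPartialSum, Pi.sub_apply, Finset.sum_apply, Finset.sum_sub_distrib]
    push_cast
    rw [mul_sub, Finset.mul_sum]
    congr 1
    refine Finset.sum_congr rfl fun n _ => ?_
    rw [coeff_srwStep_pow, Pi.smul_apply, latticeFn, smul_eq_mul]
    push_cast
    ring
  rw [h, map_sub, act_const_of_mem hd, sub_zero, map_sum, Finset.sum_apply, Finset.mul_sum]
  refine Finset.sum_congr rfl fun n _ => ?_
  rw [map_smul, act_latticeFn, Pi.smul_apply, latticeFn, smul_eq_mul, heat]
  push_cast
  ring

lemma hasSum_act_greenZ2 {d : LatticeRing} (hd : d ∈ augIdeal) {β : ℝ} (h : SupDecay d β)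
    (hβ : 1 < β) (x : ℤ × ℤ) : HasSum (fun n => (heat d n x : ℂ)) (4 * act d greenZ2 x) := by
  have h1 := Complex.hasSum_ofReal.2 (h.summable_heat hβ x).hasSum
  have h2 := tendsto_act tendsto_greenZ2 d x
  simp only [act_greenPartialSum hd] at h2
  have h3 := tendsto_nhds_unique h2 (h1.tendsto_sum_nat.const_mul (1 / 4 : ℂ))
  rw [h3]
  convert h1 using 1
  ring

/-- The Green's function is a fundamental solution of the Laplacian. -/
lemma act_lap_greenZ2 : act lap greenZ2 = basisZero := by
  ext x
  have h2 := tendsto_act tendsto_greenZ2 lap x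
  simp only [act_greenPartialSum lap_mem] at h2
  refine tendsto_nhds_unique h2 ?_
  have h4 : (4 : LatticeRing) = ((4 : ℤ) : LatticeRing) := by norm_num
  have h5 : ∀ n, heat lap n x = 4 * (heat 1 n x - heat 1 (n + 1) x) := by
    intro n
    rw [heat, heat, heat, lap, show (4 - stepSum) * stepSum ^ n =
      4 * (1 * stepSum ^ n) - 1 * stepSum ^ (n + 1) by rw [pow_succ]; ring,
      AddMonoidAlgebra.coeff_sub, Finsupp.sub_apply, h4, coeff_intCast_mul]
    push_cast
    field_simp
    ring
  have h6 : ∀ N, (1 / 4 : ℂ) * ∑ n ∈ Finset.range N, (heat lap n x : ℂ) =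
      ((heat 1 0 x - heat 1 N x : ℝ) : ℂ) := by
    intro N
    rw [← Finset.sum_range_sub' (fun n => heat 1 n x)]
    simp only [h5]
    push_cast
    rw [← Finset.mul_sum]
    ring
  simp only [h6]
  have h7 := (Complex.continuous_ofReal.tendsto _).comp
    ((supDecay_one.tendsto_heat one_pos x).const_sub (heat 1 0 x))
  have h8 : ((heat 1 0 x - 0 : ℝ) : ℂ) = basisZero x := by
    rw [← latticeFn_one]
    simp [latticeFn, heat]
  rw [← h8]
  exact h7

/-! ### Summability of the differences of the Green's function -/

lemma memℓp_latticeFn (a : LatticeRing) (p : ℝ≥0∞) : Memℓp (latticeFn a) p := by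
  refine (memℓp_zero ?_).of_exponent_ge (zero_le (a := p))
  refine a.coeff.support.finite_toSet.subset fun x hx => ?_
  simpa [latticeFn] using hx

/-- Interpolation between the `ℓ¹` and the sup norm. -/
lemma tsum_abs_rpow_le {ι : Type*} {f : ι → ℝ} {A B p : ℝ} (hp : 1 ≤ p)
    (hA : ∀ x, |f x| ≤ A) (hf : Summable fun x => |f x|) (hB : ∑' x, |f x| ≤ B)
    (hA0 : 0 ≤ A) : ∑' x, |f x| ^ p ≤ A ^ (p - 1) * B := by
  have h : ∀ x, |f x| ^ p ≤ A ^ (p - 1) * |f x| := by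
    intro x
    calc |f x| ^ p = |f x| ^ (p - 1) * |f x| := by
          rcases (abs_nonneg (f x)).eq_or_lt with h0 | h0
          · rw [← h0, Real.zero_rpow (by linarith), mul_zero]
          · rw [← Real.rpow_add_one h0.ne', sub_add_cancel]
      _ ≤ _ := mul_le_mul_of_nonneg_right
          (Real.rpow_le_rpow (abs_nonneg _) (hA x) (by linarith)) (abs_nonneg _)
  have hs := hf.mul_left (A ^ (p - 1))
  refine ((Summable.of_nonneg_of_le (fun x => by positivity) h hs).tsum_le_tsum h hs).trans ?_
  rw [tsum_mul_left]
  exact mul_le_mul_of_nonneg_left hB (by positivity)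

lemma memℓp_of_hasSum_heat {d : LatticeRing} {α : ℝ} (h1 : L1Decay d α) (h2 : SupDecay d (1 + α))
    {p : ℝ≥0∞} (hp : 1 ≤ p) (hp' : p ≠ ∞) (hα : 1 < α * p.toReal) {F : ℤ × ℤ → ℂ}
    (hF : ∀ x, HasSum (fun n => (heat d n x : ℂ)) (F x)) : Memℓp F p := by
  have : Fact (1 ≤ p) := ⟨hp⟩
  have hq1 : 1 ≤ p.toReal := by
    rw [← ENNReal.toReal_one]; exact ENNReal.toReal_mono hp' hp
  set q := p.toReal with hq
  have hq0 : 0 < q := by linarith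
  have hmem : ∀ n, Memℓp (fun x => (heat d n x : ℂ)) p := by
    intro n
    have := (memℓp_latticeFn (d * stepSum ^ n) p).const_smul ((4 : ℂ) ^ n)⁻¹
    convert this using 1
    ext x
    simp [heat, latticeFn, div_eq_inv_mul]
  let u : ℕ → lp (fun _ : ℤ × ℤ => ℂ) p := fun n => ⟨fun x => (heat d n x : ℂ), hmem n⟩
  obtain ⟨C, hC⟩ := h1
  obtain ⟨D, hD⟩ := h2.exists_abs_heat_le
  set K := max C D with hK
  have hC0 : 0 ≤ C := L1Decay.const_nonneg hC
  have hK0 : 0 ≤ K := hC0.trans (le_max_left _ _)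
  have hsumm : ∀ n, Summable fun x => |heat d n x| := by
    intro n
    simp only [heat, abs_div]
    exact (summable_abs_coeff _).div_const _
  have hu : ∀ n, ‖u n‖ ≤ K * (n + 1 : ℝ) ^ (-(1 + α - 1 / q)) := by
    intro n
    refine lp.norm_le_of_tsum_le hq0 (by positivity) ?_
    have e1 : ∀ x, ‖u n x‖ = |heat d n x| := fun x => Complex.norm_real _
    simp only [e1]
    have hB : ∑' x, |heat d n x| ≤ K * (n + 1 : ℝ) ^ (-α) := by
      simp only [heat, abs_div]
      rw [tsum_div_const, abs_of_nonneg (by positivity : (0 : ℝ) ≤ 4 ^ n),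
        div_le_iff₀ (by positivity)]
      refine (hC n).trans ?_
      rw [mul_right_comm]
      gcongr
      exact le_max_left _ _
    refine (tsum_abs_rpow_le hq1 (A := K * (n + 1 : ℝ) ^ (-(1 + α))) (fun x => (hD n x).trans ?_)
      (hsumm n) hB (by positivity)).trans_eq ?_
    · gcongr
      exact le_max_right _ _
    · have hn : (0 : ℝ) < (n : ℝ) + 1 := by positivity
      rw [← hq, Real.mul_rpow hK0 (by positivity), Real.mul_rpow hK0 (by positivity),
        ← Real.rpow_mul hn.le, ← Real.rpow_mul hn.le]
      rcases hK0.eq_or_lt with h0 | h0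
      · rw [← h0, Real.zero_rpow hq0.ne']; ring
      · have e2 : K ^ q = K ^ (q - 1) * K := by rw [← Real.rpow_add_one h0.ne', sub_add_cancel]
        have e3 : -(1 + α - 1 / q) * q = -(1 + α) * (q - 1) + -α := by field_simp; ring
        rw [e2, e3, Real.rpow_add hn]
        ring
  have hexp : 1 < 1 + α - 1 / q := by
    have : 1 / q < α := by rwa [div_lt_iff₀ hq0]
    linarith
  have hus : Summable u := Summable.of_norm_bounded ((summable_rpow_neg hexp).mul_left K) hu
  have hUF : ⇑(∑' n, u n) = F := by
    ext x
    have := (lp.evalCLM ℂ (fun _ : ℤ × ℤ => ℂ) p x).hasSum hus.hasSum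
    exact this.unique (hF x)
  rw [← hUF]
  exact lp.memℓp _

/-- A difference of order `k` of the Green's function lies in `ℓ^p` when `k * p > 2`. -/
lemma memℓp_act_greenZ2 {m : LatticeRing} (hm : m ∈ augIdeal) {k : ℕ} (hk : HasDecay m k)
    {p : ℝ≥0∞} (hp : 1 ≤ p) (hp' : p ≠ ∞) (hkp : 2 < k * p.toReal) :
    Memℓp (act m greenZ2) p := by
  set d := m * (4 + stepSum) ^ k with hd
  have hk0 : 0 < k := by
    rcases k with _ | k
    · norm_num at hkp
    · omega
  have hβ : (1 : ℝ) < 1 + k / 2 := by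
    have : (0 : ℝ) < k := by exact_mod_cast hk0
    linarith
  have h1 := memℓp_of_hasSum_heat hk.1 hk.2 hp hp' (by linarith)
    (hasSum_act_greenZ2 (augIdeal.mul_mem_right _ hm) hk.2 hβ)
  -- `4 + stepSum = 8 - lap`, and `lap` maps the Green's function to a point mass.
  obtain ⟨q, hq⟩ := sub_dvd_pow_sub_pow (8 - lap) 8 k
  have e1 : (4 + stepSum) ^ k = ((8 ^ k : ℤ) : LatticeRing) - q * lap := by
    push_cast
    have : 4 + stepSum = 8 - lap := by rw [lap]; ring
    rw [this]
    linear_combination hq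
  have e2 : act d greenZ2 = (8 ^ k : ℂ) • act m greenZ2 - latticeFn (m * q) := by
    rw [hd, e1, show m * (((8 ^ k : ℤ) : LatticeRing) - q * lap) =
      ((8 ^ k : ℤ) : LatticeRing) * m - m * q * lap by ring, act_sub, act_mul, act_mul (m * q),
      act_lap_greenZ2, act_basisZero, act_intCast]
    push_cast
    rfl
  have e3 : act m greenZ2 = ((8 : ℂ) ^ k)⁻¹ • ((1 / 4 : ℂ) • (fun x => 4 * act d greenZ2 x) +
      latticeFn (m * q)) := by
    ext x
    have := congrFun e2 x
    simp only [Pi.sub_apply, Pi.smul_apply, smul_eq_mul, Pi.add_apply] at this ⊢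
    rw [this]
    field_simp
    ring
  rw [e3]
  exact ((h1.const_smul _).add (memℓp_latticeFn _ _)).const_smul _

/-! ### Uniqueness of solutions of the Laplace equation in `ℓ^p` -/

lemma Memℓp.tendsto_cofinite {ι : Type*} {f : ι → ℂ} {p : ℝ≥0∞} (hf : Memℓp f p) (hp : 1 ≤ p)
    (hp' : p ≠ ∞) : Tendsto f cofinite (𝓝 0) := by
  have hq : 0 < p.toReal := ENNReal.toReal_pos (by positivity) hp'
  have h := (hf.summable hq).tendsto_cofinite_zero
  have h2 := (h.rpow_const (p := 1 / p.toReal) (Or.inr (by positivity)))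
  rw [Real.zero_rpow (by positivity)] at h2
  rw [tendsto_zero_iff_norm_tendsto_zero]
  refine h2.congr fun x => ?_
  rw [← Real.rpow_mul (norm_nonneg _), mul_one_div_cancel hq.ne', Real.rpow_one]

/-- Maximum principle: a real harmonic function that vanishes at infinity is nowhere positive. -/
lemma nonpos_of_harmonic {u : ℤ × ℤ → ℝ} (hu : Tendsto u cofinite (𝓝 0))
    (h : ∀ i j, 4 * u (i, j) = u (i - 1, j) + u (i + 1, j) + u (i, j - 1) + u (i, j + 1))
    (x : ℤ × ℤ) : u x ≤ 0 := by
  by_contra! hx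
  have hfin : {y | u x ≤ u y}.Finite := by
    have := hu.eventually (gt_mem_nhds hx)
    rw [eventually_cofinite] at this
    simpa using this
  obtain ⟨z, hz, hmax⟩ := hfin.exists_maximalFor u _ ⟨x, le_refl (u x)⟩
  have hle : ∀ y, u y ≤ u z := by
    intro y
    by_contra! hy
    exact absurd (hmax (le_trans hz hy.le) hy.le) (not_le.2 hy)
  -- The maximum value propagates to the right, hence is attained infinitely often.
  have hprop : ∀ n : ℕ, u (z.1 + n, z.2) = u z := by
    intro n
    induction n with
    | zero => simp
    | succ n ih =>
      have h1 := h (z.1 + n) z.2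
      have h2 := hle (z.1 + n - 1, z.2)
      have h3 := hle (z.1 + n + 1, z.2)
      have h4 := hle (z.1 + n, z.2 - 1)
      have h5 := hle (z.1 + n, z.2 + 1)
      push_cast
      rw [← add_assoc]
      linarith
  have hinj : Function.Injective fun n : ℕ => ((z.1 + n, z.2) : ℤ × ℤ) := by
    intro m n hmn
    simpa using hmn
  refine Set.infinite_of_injective_forall_mem hinj (fun n => ?_) hfin
  change u x ≤ u _
  rw [hprop]
  exact hz

lemma eq_zero_of_harmonic {f : ℤ × ℤ → ℂ} (hf : Tendsto f cofinite (𝓝 0))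
    (h : graphLaplacian f = 0) : f = 0 := by
  have key : ∀ L : ℂ →L[ℝ] ℝ, ∀ x, L (f x) ≤ 0 := by
    intro L
    refine nonpos_of_harmonic ?_ ?_
    · have h1 := (L.continuous.tendsto 0).comp hf
      rwa [map_zero] at h1
    · intro i j
      have h1 := congrFun h (i, j)
      simp only [graphLaplacian, Pi.zero_apply] at h1
      have h2 : (4 : ℝ) • f (i, j) = f (i - 1, j) + f (i + 1, j) + f (i, j - 1) + f (i, j + 1) := by
        rw [Complex.real_smul]
        push_cast
        linear_combination h1
      have h3 := congrArg L h2
      rwa [map_smul, map_add, map_add, map_add, smul_eq_mul] at h3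
  ext x
  apply Complex.ext
  · have h1 := key Complex.reCLM x
    have h2 := key (-Complex.reCLM) x
    simp at h1 h2 ⊢
    linarith
  · have h1 := key Complex.imCLM x
    have h2 := key (-Complex.imCLM) x
    simp at h1 h2 ⊢
    linarith

/-! ### The Laplacian of a function in `ℓ^p` that is harmonic modulo one -/

lemma Memℓp.translate {f : ℤ × ℤ → ℂ} {p : ℝ≥0∞} (hf : Memℓp f p) (hp : 1 ≤ p) (hp' : p ≠ ∞)
    (y : ℤ × ℤ) : Memℓp (translateZ2 y f) p := by
  have hq : 0 < p.toReal := ENNReal.toReal_pos (by positivity) hp'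
  exact memℓp_gen ((Equiv.subRight y).summable_iff.2 (hf.summable hq))

lemma Memℓp.act {f : ℤ × ℤ → ℂ} {p : ℝ≥0∞} (hf : Memℓp f p) (hp : 1 ≤ p) (hp' : p ≠ ∞)
    (a : LatticeRing) : Memℓp (act a f) p := by
  induction a using latticeRing_induction with
  | hadd a b ha hb => rw [act_add]; exact ha.add hb
  | hmono c y =>
    rw [act_mul, act_intCast, act_tau_eq]
    exact (hf.translate hp hp' y).const_smul _

/-- An integer valued function that vanishes at infinity is an element of the group ring. -/
lemma exists_eq_latticeFn {g : ℤ × ℤ → ℂ} (hg : Tendsto g cofinite (𝓝 0))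
    (hint : ∀ x, ∃ n : ℤ, g x = n) : ∃ a : LatticeRing, g = latticeFn a := by
  choose n hn using hint
  have hfin : n.support.Finite := by
    have h1 := hg.eventually (Metric.ball_mem_nhds 0 one_pos)
    rw [eventually_cofinite] at h1
    refine h1.subset fun x hx hx' => hx ?_
    rw [hn, dist_zero_right, Complex.norm_intCast] at hx'
    exact Int.abs_lt_one_iff.1 (by exact_mod_cast hx')
  refine ⟨AddMonoidAlgebra.ofCoeff (Finsupp.ofSupportFinite n hfin), ?_⟩
  ext x
  rw [hn]
  rfl

lemma exists_act_lap_eq {f : ℤ × ℤ → ℂ} {p : ℝ≥0∞} (hf : f ∈ harmonicModOneLp p) (hp : 1 ≤ p)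
    (hp' : p ≠ ∞) : ∃ a : LatticeRing, act lap f = act a basisZero := by
  obtain ⟨a, ha⟩ := exists_eq_latticeFn ((hf.1.act hp hp' lap).tendsto_cofinite hp hp')
    (fun x => by rw [act_lap]; exact hf.2 x)
  exact ⟨a, by rw [ha, act_basisZero]⟩

/-! ### Pairing with finitely supported functions -/

/-- The convolution of `f` with a finitely supported function `h`, evaluated at the origin. -/
noncomputable def pairing (f h : ℤ × ℤ → ℂ) : ℂ := ∑' y, f (-y) * h y

lemma act_support_finite {h : ℤ × ℤ → ℂ} (hh : h.support.Finite) (a : LatticeRing) :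
    (act a h).support.Finite := by
  induction a using latticeRing_induction with
  | hadd a b ha hb =>
    rw [act_add]
    exact (ha.union hb).subset (Function.support_add _ _)
  | hmono c y =>
    rw [act_mul, act_intCast]
    refine ((hh.image (· + y)).subset fun x hx => ?_)
    refine ⟨x - y, ?_, by simp⟩
    intro h0
    apply hx
    rw [Pi.smul_apply, act_tau, h0, smul_zero]

lemma summable_pairing (f : ℤ × ℤ → ℂ) {h : ℤ × ℤ → ℂ} (hh : h.support.Finite) :
    Summable fun y => f (-y) * h y :=
  summable_of_hasFiniteSupport (hh.subset fun _ hy h0 => hy (by simp [h0]))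

/-- The action of the group ring can be moved from one side of the pairing to the other. -/
lemma pairing_act (f : ℤ × ℤ → ℂ) {h : ℤ × ℤ → ℂ} (hh : h.support.Finite) (a : LatticeRing) :
    pairing (act a f) h = pairing f (act a h) := by
  induction a using latticeRing_induction with
  | hadd a b ha hb =>
    rw [pairing, pairing, act_add, act_add] at *
    simp only [Pi.add_apply, add_mul, mul_add]
    rw [(summable_pairing _ hh).tsum_add (summable_pairing _ hh),
      (summable_pairing _ (act_support_finite hh a)).tsum_add
        (summable_pairing _ (act_support_finite hh b))]
    exact congrArg₂ (· + ·) ha hb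
  | hmono c y =>
    rw [pairing, pairing, act_mul, act_mul, act_intCast, act_intCast]
    simp only [Pi.smul_apply, act_tau, smul_eq_mul]
    rw [← (Equiv.subRight y).tsum_eq]
    refine tsum_congr fun z => ?_
    simp only [Equiv.subRight_apply]
    rw [show -(z - y) - y = -z by abel]
    ring

lemma pairing_basisZero (h : ℤ × ℤ → ℂ) : pairing basisZero h = h 0 := by
  rw [pairing, tsum_eq_single 0]
  · simp [basisZero, Prod.ext_iff]
  · intro y hy
    rw [basisZero, if_neg, zero_mul]
    intro h0
    exact hy (neg_eq_zero.1 h0)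

lemma act_apply_zero_eq_pairing {f : ℤ × ℤ → ℂ} {a : LatticeRing}
    (h : act lap f = act a basisZero) {φ : ℤ × ℤ → ℂ} (hφ : φ.support.Finite) :
    act a φ 0 = pairing f (act lap φ) := by
  rw [← pairing_act _ hφ, h, pairing_act _ hφ, pairing_basisZero]

/-! ### Compactly supported approximations of harmonic polynomials -/

/-- `h` is a pointwise limit of functions `φ R` supported in boxes of size `O(R)` whose Laplacians
are of size `O(R ^ (m - 2))`, as for a harmonic polynomial of degree `m` with a cutoff at scale
`R`. The scale is `R + 1`, so that it does not vanish. -/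
def HasCutoffs (h : ℤ × ℤ → ℂ) (m : ℕ) : Prop :=
  ∃ (φ : ℕ → ℤ × ℤ → ℂ) (C : ℝ), (∀ x, Tendsto (fun R => φ R x) atTop (𝓝 (h x))) ∧
    (∀ R, (φ R).support.Finite) ∧
    (∀ (R : ℕ) x, ‖act lap (φ R) x‖ ≤ C * (R + 1 : ℝ) ^ m / (R + 1 : ℝ) ^ 2) ∧
    ∀ (R : ℕ) (x : ℤ × ℤ), x ∉ Finset.Icc (-(3 * (R + 1) : ℤ)) (3 * (R + 1)) ×ˢ
      Finset.Icc (-(3 * (R + 1) : ℤ)) (3 * (R + 1)) → act lap (φ R) x = 0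

lemma HasCutoffs.sub {h k : ℤ × ℤ → ℂ} {m : ℕ} (hh : HasCutoffs h m) (hk : HasCutoffs k m) :
    HasCutoffs (h - k) m := by
  obtain ⟨φ, C, h1, h2, h3, h4⟩ := hh
  obtain ⟨ψ, D, k1, k2, k3, k4⟩ := hk
  refine ⟨fun R => φ R - ψ R, C + D, fun x => (h1 x).sub (k1 x), fun R => ?_, fun R x => ?_,
    fun R x hx => ?_⟩
  · exact ((h2 R).union (k2 R)).subset (Function.support_sub _ _)
  · rw [map_sub, Pi.sub_apply]
    refine (norm_sub_le _ _).trans ((add_le_add (h3 R x) (k3 R x)).trans_eq ?_)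
    ring
  · rw [map_sub, Pi.sub_apply, h4 R x hx, k4 R x hx, sub_zero]

/-- The Laplacian of a function in `ℓ^p` annihilates the harmonic polynomials of degree `m` when
`m * p ≤ 2`. -/
lemma act_eq_zero_of_hasCutoffs {f : ℤ × ℤ → ℂ} {p : ℝ≥0∞} (hf : Memℓp f p) (hp : 1 ≤ p)
    (hp' : p ≠ ∞) {a : LatticeRing} (ha : act lap f = act a basisZero) {h : ℤ × ℤ → ℂ} {m : ℕ}
    (hh : HasCutoffs h m) (hharm : act lap h = 0) (hmp : m * p.toReal ≤ 2) : act a h 0 = 0 := by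
  obtain ⟨φ, C, h1, h2, h3, h4⟩ := hh
  have hq1 : 1 ≤ p.toReal := by
    rw [← ENNReal.toReal_one]; exact ENNReal.toReal_mono hp' hp
  set q := p.toReal with hq
  have hq0 : 0 < q := by linarith
  have hC0 : 0 ≤ C := by simpa using (norm_nonneg _).trans (h3 0 0)
  refine tendsto_nhds_unique (tendsto_act h1 a 0) ?_
  simp only [fun R => act_apply_zero_eq_pairing ha (h2 R)]
  have hsum : Summable fun y : ℤ × ℤ => ‖f (-y)‖ ^ q :=
    (Equiv.neg (ℤ × ℤ)).summable_iff.2 (hf.summable hq0)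
  rw [Metric.tendsto_atTop]
  intro ε hε
  -- The tail of `f` outside a finite set `S` contributes at most `ε / 2`.
  obtain ⟨δ, hδ, hδε⟩ : ∃ δ > 0, C * (49 ^ (q - 1) * δ) ^ (1 / q) ≤ ε / 2 := by
    have hc : Tendsto (fun δ : ℝ => C * (49 ^ (q - 1) * δ) ^ (1 / q)) (𝓝[>] 0) (𝓝 0) := by
      have : ContinuousAt (fun δ : ℝ => C * (49 ^ (q - 1) * δ) ^ (1 / q)) 0 := by
        refine continuousAt_const.mul (ContinuousAt.rpow_const (by fun_prop) (Or.inr ?_))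
        positivity
      have h0 := this.tendsto
      simp only [mul_zero] at h0
      rw [Real.zero_rpow (by positivity), mul_zero] at h0
      exact h0.mono_left nhdsWithin_le_nhds
    obtain ⟨δ, hδ1, hδ2⟩ := ((hc.eventually (gt_mem_nhds (half_pos hε))).and
      self_mem_nhdsWithin).exists
    exact ⟨δ, hδ2, hδ1.le⟩
  obtain ⟨S, hS⟩ := summable_iff_vanishing_norm.1 hsum δ hδ
  have htail : ∀ (R : ℕ) (B : Finset (ℤ × ℤ)), Disjoint B S →
      B ⊆ Finset.Icc (-(3 * (R + 1) : ℤ)) (3 * (R + 1)) ×ˢ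
        Finset.Icc (-(3 * (R + 1) : ℤ)) (3 * (R + 1)) →
      ‖∑ y ∈ B, f (-y) * act lap (φ R) y‖ ≤ ε / 2 := by
    intro R B hBS hB
    have hr : (0 : ℝ) < (R : ℝ) + 1 := by positivity
    have hr1 : (1 : ℝ) ≤ (R : ℝ) + 1 := by linarith [(Nat.cast_nonneg R : (0 : ℝ) ≤ R)]
    set r : ℝ := (R : ℝ) + 1 with hr'
    have hcard : (B.card : ℝ) ≤ 49 * r ^ 2 := by
      have e1 := Finset.card_le_card hB
      rw [Finset.card_product, Int.card_Icc] at e1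
      have e2 : (3 * ((R : ℤ) + 1) + 1 - -(3 * ((R : ℤ) + 1))).toNat = 6 * R + 7 := by omega
      rw [e2] at e1
      have e3 : (B.card : ℝ) ≤ (6 * R + 7) * (6 * R + 7) := by exact_mod_cast e1
      refine e3.trans ?_
      rw [hr']
      nlinarith [(Nat.cast_nonneg R : (0 : ℝ) ≤ R)]
    have hpow : (∑ y ∈ B, ‖f (-y)‖) ^ q ≤ (49 * r ^ 2) ^ (q - 1) * δ := by
      have e1 := Real.rpow_sum_le_const_mul_sum_rpow_of_nonneg B hq1
        (f := fun y => ‖f (-y)‖) (fun _ _ => norm_nonneg _)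
      refine e1.trans ?_
      have e2 := hS B hBS
      rw [Real.norm_of_nonneg (Finset.sum_nonneg fun _ _ => by positivity)] at e2
      have e3 : (B.card : ℝ) ^ (q - 1) ≤ (49 * r ^ 2) ^ (q - 1) :=
        Real.rpow_le_rpow (Nat.cast_nonneg _) hcard (by linarith)
      exact mul_le_mul e3 e2.le (Finset.sum_nonneg fun _ _ => by positivity) (by positivity)
    have hmain : (∑ y ∈ B, ‖f (-y)‖) * (r ^ m / r ^ 2) ≤ (49 ^ (q - 1) * δ) ^ (1 / q) := by
      have e0 : 0 ≤ (∑ y ∈ B, ‖f (-y)‖) := Finset.sum_nonneg fun _ _ => norm_nonneg _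
      rw [← Real.rpow_le_rpow_iff (by positivity) (by positivity) hq0,
        ← Real.rpow_mul (by positivity), one_div_mul_cancel hq0.ne', Real.rpow_one,
        Real.mul_rpow e0 (by positivity)]
      have e1 : (r ^ m / r ^ 2) ^ q = r ^ (m * q - 2 * q) := by
        rw [← Real.rpow_natCast, ← Real.rpow_natCast, ← Real.rpow_sub hr, ← Real.rpow_mul hr.le]
        push_cast
        ring_nf
      have e2 : (49 * r ^ 2) ^ (q - 1) = 49 ^ (q - 1) * r ^ (2 * q - 2) := by
        rw [Real.mul_rpow (by norm_num) (by positivity), ← Real.rpow_natCast,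
          ← Real.rpow_mul hr.le]
        push_cast
        ring_nf
      rw [e1]
      calc (∑ y ∈ B, ‖f (-y)‖) ^ q * r ^ (m * q - 2 * q)
          ≤ (49 * r ^ 2) ^ (q - 1) * δ * r ^ (m * q - 2 * q) := by gcongr
        _ = 49 ^ (q - 1) * δ * r ^ (m * q - 2) := by
          rw [e2, show m * q - 2 = (2 * q - 2) + (m * q - 2 * q) by ring, Real.rpow_add hr]
          ring
        _ ≤ 49 ^ (q - 1) * δ * 1 := by
          gcongr
          exact Real.rpow_le_one_of_one_le_of_nonpos hr1 (by linarith)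
        _ = 49 ^ (q - 1) * δ := mul_one _
    calc ‖∑ y ∈ B, f (-y) * act lap (φ R) y‖ ≤ ∑ y ∈ B, ‖f (-y)‖ * (C * r ^ m / r ^ 2) := by
          refine (norm_sum_le _ _).trans (Finset.sum_le_sum fun y _ => ?_)
          rw [norm_mul]
          exact mul_le_mul_of_nonneg_left (h3 R y) (norm_nonneg _)
      _ = C * ((∑ y ∈ B, ‖f (-y)‖) * (r ^ m / r ^ 2)) := by rw [← Finset.sum_mul]; ring
      _ ≤ C * (49 ^ (q - 1) * δ) ^ (1 / q) := by gcongr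
      _ ≤ ε / 2 := hδε
  have hhead : Tendsto (fun R => ∑ y ∈ S, f (-y) * act lap (φ R) y) atTop (𝓝 0) := by
    have : Tendsto (fun R => ∑ y ∈ S, f (-y) * act lap (φ R) y) atTop
        (𝓝 (∑ y ∈ S, f (-y) * act lap h y)) :=
      tendsto_finsetSum _ fun y _ => (tendsto_act h1 lap y).const_mul _
    simpa [hharm] using this
  obtain ⟨N, hN⟩ := Metric.tendsto_atTop.1 hhead (ε / 2) (half_pos hε)
  refine ⟨N, fun R hR => ?_⟩
  rw [dist_zero_right]
  have hN' := hN R hR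
  rw [dist_zero_right] at hN'
  set Q := Finset.Icc (-(3 * (R + 1) : ℤ)) (3 * (R + 1)) ×ˢ
      Finset.Icc (-(3 * (R + 1) : ℤ)) (3 * (R + 1)) with hQ
  have hsplit : pairing f (act lap (φ R)) = ∑ y ∈ S, f (-y) * act lap (φ R) y +
      ∑ y ∈ Q \ S, f (-y) * act lap (φ R) y := by
    rw [← Finset.sum_union Finset.disjoint_sdiff, Finset.union_sdiff_self_eq_union]
    refine tsum_eq_sum fun y hy => ?_
    rw [h4 R y (fun hy' => hy (Finset.mem_union_right _ hy')), mul_zero]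
  rw [hsplit]
  have := htail R (Q \ S) Finset.sdiff_disjoint Finset.sdiff_subset
  linarith [norm_add_le (∑ y ∈ S, f (-y) * act lap (φ R) y)
    (∑ y ∈ Q \ S, f (-y) * act lap (φ R) y)]

/-! ### Cutoffs of monomials -/

lemma abs_second_difference_le {ψ : ℝ → ℝ} (hψ : ContDiff ℝ 2 ψ) {K : ℝ}
    (hK : ∀ s, ‖deriv (deriv ψ) s‖ ≤ K) (x h : ℝ) :
    |ψ (x + h) + ψ (x - h) - 2 * ψ x| ≤ K * h ^ 2 := by
  have hd : Differentiable ℝ ψ := hψ.differentiable (by norm_num)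
  have hd1 : ContDiff ℝ 1 (deriv ψ) := by
    have h2 : (2 : WithTop ℕ∞) = 1 + 1 := by norm_num
    rw [h2, contDiff_succ_iff_deriv] at hψ
    exact hψ.2.2
  have hd' : Differentiable ℝ (deriv ψ) := hd1.differentiable (by norm_num)
  have hlip : ∀ a b, ‖deriv ψ a - deriv ψ b‖ ≤ K * ‖a - b‖ := fun a b =>
    Convex.norm_image_sub_le_of_norm_deriv_le (fun s _ => hd' s) (fun s _ => hK s)
      convex_univ (Set.mem_univ b) (Set.mem_univ a)
  have hΨ : ∀ y, HasDerivAt (fun y => ψ (y + h) - ψ y) (deriv ψ (y + h) - deriv ψ y) y := by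
    intro y
    exact ((hd (y + h)).hasDerivAt.comp_add_const y h).sub (hd y).hasDerivAt
  have hmain := Convex.norm_image_sub_le_of_norm_hasDerivWithin_le (C := K * ‖h‖)
    (fun y _ => (hΨ y).hasDerivWithinAt) (fun y _ => by
      have := hlip (y + h) y
      rwa [add_sub_cancel_left] at this) convex_univ (Set.mem_univ (x - h)) (Set.mem_univ x)
  have e1 : ψ (x + h) + ψ (x - h) - 2 * ψ x =
      ψ (x + h) - ψ x - (ψ (x - h + h) - ψ (x - h)) := by
    rw [sub_add_cancel]; ring
  rw [e1, ← Real.norm_eq_abs]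
  refine hmain.trans_eq ?_
  rw [sub_sub_cancel, mul_assoc, Real.norm_eq_abs, abs_mul_abs_self, sq]

/-- A smooth cutoff at scale `R + 1` of the monomial `i ^ m` on `ℤ`. -/
lemma exists_monomial_cutoffs (m : ℕ) : ∃ (u : ℕ → ℤ → ℝ) (C : ℝ), 0 ≤ C ∧
    (∀ i, Tendsto (fun R => u R i) atTop (𝓝 ((i : ℝ) ^ m))) ∧
    (∀ (R : ℕ) i, |u R i| ≤ C * (R + 1 : ℝ) ^ m) ∧
    (∀ (R : ℕ) i, |u R (i + 1) + u R (i - 1) - 2 * u R i| ≤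
      C * (R + 1 : ℝ) ^ m / (R + 1 : ℝ) ^ 2) ∧
    ∀ (R : ℕ) i, (2 * (R + 1) : ℤ) ≤ |i| → u R i = 0 := by
  let η : ContDiffBump (0 : ℝ) := ⟨1, 2, one_pos, one_lt_two⟩
  set ψ : ℝ → ℝ := fun s => s ^ m * η s with hψdef
  have hψ : ContDiff ℝ 2 ψ := (contDiff_id.pow m).mul η.contDiff
  have hcs : HasCompactSupport ψ := η.hasCompactSupport.mul_left
  have hd1 : ContDiff ℝ 1 (deriv ψ) := by
    have h2 : (2 : WithTop ℕ∞) = 1 + 1 := by norm_num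
    have := hψ
    rw [h2, contDiff_succ_iff_deriv] at this
    exact this.2.2
  obtain ⟨K₀, hK₀⟩ := hcs.exists_bound_of_continuous hψ.continuous
  obtain ⟨K₂, hK₂⟩ := hcs.deriv.deriv.exists_bound_of_continuous (hd1.continuous_deriv le_rfl)
  have h0 : 0 ≤ K₀ := (norm_nonneg _).trans (hK₀ 0)
  have hr : ∀ R : ℕ, (0 : ℝ) < (R : ℝ) + 1 := fun R => by positivity
  refine ⟨fun R i => (R + 1 : ℝ) ^ m * ψ (i / (R + 1)), max K₀ K₂, h0.trans (le_max_left _ _),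
    fun i => ?_, fun R i => ?_, fun R i => ?_, fun R i hi => ?_⟩
  · refine tendsto_const_nhds.congr' ?_
    filter_upwards [eventually_ge_atTop i.natAbs] with R hR
    have h1 : η (i / (R + 1) : ℝ) = 1 := by
      refine η.one_of_mem_closedBall ?_
      rw [mem_closedBall_zero_iff, Real.norm_eq_abs, abs_div, abs_of_pos (hr R),
        div_le_one (hr R)]
      have : ((|i| : ℤ) : ℝ) ≤ (R : ℝ) := by
        have : |i| ≤ (R : ℤ) := abs_le.2 (by omega)
        exact_mod_cast this
      push_cast at this
      linarith
    simp only [hψdef]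
    rw [h1, mul_one, div_pow, mul_div_cancel₀ _ (pow_ne_zero m (hr R).ne')]
  · rw [abs_mul, abs_of_pos (pow_pos (hr R) m), mul_comm]
    exact mul_le_mul_of_nonneg_right ((hK₀ _).trans (le_max_left _ _)) (pow_pos (hr R) m).le
  · have h1 := abs_second_difference_le hψ hK₂ (i / (R + 1)) (1 / (R + 1))
    have h2 : (((i + 1 : ℤ) : ℝ)) / (R + 1) = i / (R + 1) + 1 / (R + 1) := by
      push_cast; ring
    have h3 : (((i - 1 : ℤ) : ℝ)) / (R + 1) = i / (R + 1) - 1 / (R + 1) := by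
      push_cast; ring
    simp only [h2, h3]
    rw [show ∀ A B D E : ℝ, A * B + A * D - 2 * (A * E) = A * (B + D - 2 * E) by intros; ring,
      abs_mul, abs_of_pos (pow_pos (hr R) m)]
    calc _ ≤ (R + 1 : ℝ) ^ m * (K₂ * (1 / (R + 1)) ^ 2) := by gcongr
      _ ≤ (R + 1 : ℝ) ^ m * (max K₀ K₂ * (1 / (R + 1)) ^ 2) := by
        gcongr
        exact le_max_right _ _
      _ = _ := by rw [div_pow, one_pow]; ring
  · have h1 : η (i / (R + 1) : ℝ) = 0 := by
      refine η.zero_of_le_dist ?_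
      rw [dist_zero_right, Real.norm_eq_abs, abs_div, abs_of_pos (hr R)]
      change (2 : ℝ) ≤ _
      rw [le_div_iff₀ (hr R)]
      exact_mod_cast hi
    simp only [hψdef]
    rw [h1, mul_zero, mul_zero]

/-- The monomial `i ^ a * j ^ b` on `ℤ²`. -/
noncomputable def monomialFn (a b : ℕ) (x : ℤ × ℤ) : ℂ := (x.1 : ℂ) ^ a * (x.2 : ℂ) ^ b

lemma hasCutoffs_monomialFn (a b : ℕ) : HasCutoffs (monomialFn a b) (a + b) := by
  obtain ⟨u, C, hC, u1, u2, u3, u4⟩ := exists_monomial_cutoffs a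
  obtain ⟨v, D, hD, v1, v2, v3, v4⟩ := exists_monomial_cutoffs b
  have hlap : ∀ (R : ℕ) (x : ℤ × ℤ),
      act lap (fun x : ℤ × ℤ => ((u R x.1 * v R x.2 : ℝ) : ℂ)) x =
      ((-((u R (x.1 + 1) + u R (x.1 - 1) - 2 * u R x.1) * v R x.2 +
        u R x.1 * (v R (x.2 + 1) + v R (x.2 - 1) - 2 * v R x.2)) : ℝ) : ℂ) := by
    intro R x
    rw [act_lap, graphLaplacian]
    push_cast
    ring
  refine ⟨fun R x => ((u R x.1 * v R x.2 : ℝ) : ℂ), 2 * (C * D), fun x => ?_, fun R => ?_,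
    fun R x => ?_, fun R x hx => ?_⟩
  · have h := (Complex.continuous_ofReal.tendsto _).comp ((u1 x.1).mul (v1 x.2))
    simpa [monomialFn, Function.comp_def] using h
  · refine ((Finset.Icc (-(2 * (R + 1) : ℤ)) (2 * (R + 1)) ×ˢ
      Finset.Icc (-(2 * (R + 1) : ℤ)) (2 * (R + 1))).finite_toSet).subset fun x hx => ?_
    by_contra hx'
    apply hx
    have h : (2 * (R + 1) : ℤ) ≤ |x.1| ∨ (2 * (R + 1) : ℤ) ≤ |x.2| := by
      by_contra! h
      rw [abs_lt, abs_lt] at h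
      apply hx'
      rw [Finset.mem_coe, Finset.mem_product, Finset.mem_Icc, Finset.mem_Icc]
      omega
    rcases h with h | h
    · simp [u4 R _ h]
    · simp [v4 R _ h]
  · rw [hlap, Complex.norm_real, norm_neg]
    refine (norm_add_le _ _).trans ?_
    rw [norm_mul, norm_mul]
    have h1 := mul_le_mul (u3 R x.1) (v2 R x.2) (abs_nonneg _) (by positivity)
    have h2 := mul_le_mul (u2 R x.1) (v3 R x.2) (abs_nonneg _) (by positivity)
    refine (add_le_add h1 h2).trans_eq ?_
    rw [pow_add]
    ring
  · have h : 3 * (R + 1 : ℤ) < |x.1| ∨ 3 * (R + 1 : ℤ) < |x.2| := by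
      by_contra! h
      rw [abs_le, abs_le] at h
      apply hx
      rw [Finset.mem_product, Finset.mem_Icc, Finset.mem_Icc]
      omega
    rw [hlap]
    have hz : ∀ i : ℤ, 3 * (R + 1 : ℤ) < |i| → (2 * (R + 1) : ℤ) ≤ |i| ∧
        (2 * (R + 1) : ℤ) ≤ |i + 1| ∧ (2 * (R + 1) : ℤ) ≤ |i - 1| := by
      intro i hi
      rw [lt_abs] at hi
      simp only [le_abs]
      omega
    rcases h with h | h
    · obtain ⟨h1, h2, h3⟩ := hz _ h
      simp [u4 R _ h1, u4 R _ h2, u4 R _ h3]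
    · obtain ⟨h1, h2, h3⟩ := hz _ h
      simp [v4 R _ h1, v4 R _ h2, v4 R _ h3]

/-! ### Moments and powers of the augmentation ideal -/

lemma monomialFn_zero_zero : monomialFn 0 0 = fun _ => 1 := by
  ext x; simp [monomialFn]

lemma act_intCast_add_apply_one (c : ℤ) (b₁ b₂ : LatticeRing) :
    act ((c : LatticeRing) + b₁ * diff1 + b₂ * diff2) (monomialFn 0 0) 0 = c := by
  rw [monomialFn_zero_zero, act_add, act_add, act_mul, act_mul, act_diff1_const,
    act_diff2_const, act_intCast]
  simp

lemma act_diff1_monomialFn_one_zero : act diff1 (monomialFn 1 0) = monomialFn 0 0 := by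
  rw [act_diff1]; ext x; simp [discD1, monomialFn]

lemma act_diff2_monomialFn_one_zero : act diff2 (monomialFn 1 0) = 0 := by
  rw [act_diff2]; ext x; simp [discD2, monomialFn]

lemma act_diff1_monomialFn_zero_one : act diff1 (monomialFn 0 1) = 0 := by
  rw [act_diff1]; ext x; simp [discD1, monomialFn]

lemma act_diff2_monomialFn_zero_one : act diff2 (monomialFn 0 1) = monomialFn 0 0 := by
  rw [act_diff2]; ext x; simp [discD2, monomialFn]

lemma act_second_diff_monomialFn_one_one (b₁ b₂ b₃ : LatticeRing) :
    act (b₁ * diff1 ^ 2 + b₂ * (diff1 * diff2) + b₃ * diff2 ^ 2) (monomialFn 1 1) =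
      act b₂ (monomialFn 0 0) := by
  have h1 : act (diff1 ^ 2) (monomialFn 1 1) = 0 := by
    rw [sq, act_mul, act_diff1, act_diff1]; ext x; simp [discD1, monomialFn]; ring
  have h2 : act (diff1 * diff2) (monomialFn 1 1) = monomialFn 0 0 := by
    rw [act_mul, act_diff1, act_diff2]; ext x; simp [discD1, discD2, monomialFn]; ring
  have h3 : act (diff2 ^ 2) (monomialFn 1 1) = 0 := by
    rw [sq, act_mul, act_diff2, act_diff2]; ext x; simp [discD2, monomialFn]; ring
  rw [act_add, act_add, act_mul, act_mul, act_mul b₃, h1, h2, h3]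
  simp

lemma act_second_diff_sub (b₁ b₂ b₃ : LatticeRing) :
    act (b₁ * diff1 ^ 2 + b₂ * (diff1 * diff2) + b₃ * diff2 ^ 2)
      (monomialFn 2 0 - monomialFn 0 2) =
      (2 : ℂ) • (act b₁ (monomialFn 0 0) - act b₃ (monomialFn 0 0)) := by
  have h1 : act (diff1 ^ 2) (monomialFn 2 0 - monomialFn 0 2) = (2 : ℂ) • monomialFn 0 0 := by
    rw [sq, act_mul, act_diff1, act_diff1]; ext x; simp [discD1, monomialFn]; ring
  have h2 : act (diff1 * diff2) (monomialFn 2 0 - monomialFn 0 2) = 0 := by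
    rw [act_mul, act_diff1, act_diff2]; ext x; simp [discD1, discD2, monomialFn]
  have h3 : act (diff2 ^ 2) (monomialFn 2 0 - monomialFn 0 2) = -((2 : ℂ) • monomialFn 0 0) := by
    rw [sq, act_mul, act_diff2, act_diff2]; ext x; simp [discD2, monomialFn]; ring
  rw [act_add, act_add, act_mul, act_mul, act_mul b₃, h1, h2, h3, map_zero, map_neg, map_smul,
    map_smul, smul_sub]
  abel

section Moments

variable {f : ℤ × ℤ → ℂ} {p : ℝ≥0∞} {a : LatticeRing}

lemma exists_eq_first_order (hf : Memℓp f p) (hp : 1 ≤ p) (hp' : p ≠ ∞)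
    (ha : act lap f = act a basisZero) :
    ∃ b₁ b₂ : LatticeRing, a = b₁ * diff1 + b₂ * diff2 := by
  obtain ⟨c, b₁, b₂, rfl⟩ := exists_eq_intCast_add a
  have h := act_eq_zero_of_hasCutoffs hf hp hp' ha (hasCutoffs_monomialFn 0 0)
    (by rw [act_lap]; ext x; simp [graphLaplacian, monomialFn]; ring) (by simp)
  rw [act_intCast_add_apply_one] at h
  have hc : c = 0 := by exact_mod_cast h
  exact ⟨b₁, b₂, by rw [hc]; simp⟩

lemma exists_eq_second_order (hf : Memℓp f p) (hp : 1 ≤ p) (hp' : p ≤ 2)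
    (ha : act lap f = act a basisZero) :
    ∃ b₁ b₂ b₃ : LatticeRing, a = b₁ * diff1 ^ 2 + b₂ * (diff1 * diff2) + b₃ * diff2 ^ 2 := by
  have htop : p ≠ ∞ := ne_top_of_le_ne_top (by norm_num) hp'
  have hp2 : p.toReal ≤ 2 := by
    simpa using ENNReal.toReal_mono (by norm_num) hp'
  obtain ⟨b₁, b₂, rfl⟩ := exists_eq_first_order hf hp htop ha
  have h1 := act_eq_zero_of_hasCutoffs hf hp htop ha (hasCutoffs_monomialFn 1 0)
    (by rw [act_lap]; ext x; simp [graphLaplacian, monomialFn]; ring) (by simpa using hp2)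
  have h2 := act_eq_zero_of_hasCutoffs hf hp htop ha (hasCutoffs_monomialFn 0 1)
    (by rw [act_lap]; ext x; simp [graphLaplacian, monomialFn]; ring) (by simpa using hp2)
  rw [act_add, act_mul, act_mul, act_diff1_monomialFn_one_zero, act_diff2_monomialFn_one_zero,
    map_zero, add_zero] at h1
  rw [act_add, act_mul, act_mul, act_diff1_monomialFn_zero_one, act_diff2_monomialFn_zero_one,
    map_zero, zero_add] at h2
  obtain ⟨c₁, b₁₁, b₁₂, rfl⟩ := exists_eq_intCast_add b₁
  obtain ⟨c₂, b₂₁, b₂₂, rfl⟩ := exists_eq_intCast_add b₂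
  rw [act_intCast_add_apply_one] at h1 h2
  have hc₁ : c₁ = 0 := by exact_mod_cast h1
  have hc₂ : c₂ = 0 := by exact_mod_cast h2
  subst hc₁ hc₂
  exact ⟨b₁₁, b₁₂ + b₂₁, b₂₂, by push_cast; ring⟩

/-- For `p = 1` the second moments of `a` agree with those of a multiple of the Laplacian. -/
lemma exists_eq_third_order (hf : Memℓp f 1) (ha : act lap f = act a basisZero) :
    ∃ (c : ℤ) (b₁ b₂ b₃ b₄ : LatticeRing), a = b₁ * (diff1 * (diff1 * diff1)) +
      b₂ * (diff1 * (diff1 * diff2)) + b₃ * (diff1 * (diff2 * diff2)) +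
      b₄ * (diff2 * (diff2 * diff2)) + c * lap := by
  obtain ⟨b₁, b₂, b₃, rfl⟩ := exists_eq_second_order hf le_rfl (by norm_num) ha
  have h1 := act_eq_zero_of_hasCutoffs hf le_rfl (by norm_num) ha (hasCutoffs_monomialFn 1 1)
    (by rw [act_lap]; ext x; simp [graphLaplacian, monomialFn]; ring) (by norm_num)
  have h2 := act_eq_zero_of_hasCutoffs hf le_rfl (by norm_num) ha
    ((hasCutoffs_monomialFn 2 0).sub (hasCutoffs_monomialFn 0 2))
    (by rw [act_lap]; ext x; simp [graphLaplacian, monomialFn]; ring) (by norm_num)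
  rw [act_second_diff_monomialFn_one_one] at h1
  rw [act_second_diff_sub, Pi.smul_apply, Pi.sub_apply] at h2
  obtain ⟨c₁, b₁₁, b₁₂, rfl⟩ := exists_eq_intCast_add b₁
  obtain ⟨c₂, b₂₁, b₂₂, rfl⟩ := exists_eq_intCast_add b₂
  obtain ⟨c₃, b₃₁, b₃₂, rfl⟩ := exists_eq_intCast_add b₃
  rw [act_intCast_add_apply_one] at h1
  rw [act_intCast_add_apply_one, act_intCast_add_apply_one] at h2
  have hc₂ : c₂ = 0 := by exact_mod_cast h1
  have hc₃ : c₁ = c₃ := by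
    have : (c₁ : ℂ) - c₃ = 0 := by simpa using h2
    exact_mod_cast sub_eq_zero.1 this
  subst hc₂ hc₃
  have e1 : tau (1, 0) * tau (-1, 0) = 1 := by rw [tau_mul]; rfl
  have e2 : tau (0, 1) * tau (0, -1) = 1 := by rw [tau_mul]; rfl
  have e1' : tau (1, 0) = 1 - tau (1, 0) * diff1 := by rw [diff1]; linear_combination e1
  have e2' : tau (0, 1) = 1 - tau (0, 1) * diff2 := by rw [diff2]; linear_combination e2
  refine ⟨-c₁, b₁₁ + c₁ * tau (1, 0), b₁₂ + b₂₁, b₂₂ + b₃₁, b₃₂ + c₁ * tau (0, 1), ?_⟩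
  rw [lap_eq]
  push_cast
  linear_combination (-c₁ * diff1 ^ 2) * e1' + (-c₁ * diff2 ^ 2) * e2'

end Moments

/-! ### Integer combinations of translates -/

lemma act_mem_translateSpan {S : Set (ℤ × ℤ → ℂ)} {f : ℤ × ℤ → ℂ} (hf : f ∈ S)
    (b : LatticeRing) : act b f ∈ translateSpan S := by
  induction b using latticeRing_induction with
  | hadd a b ha hb => rw [act_add]; exact add_mem ha hb
  | hmono c y =>
    rw [act_mul, act_intCast, act_tau_eq, Int.cast_smul_eq_zsmul]
    exact Submodule.smul_mem _ _ (Submodule.subset_span ⟨f, hf, y, rfl⟩)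

lemma mem_harmonicModOneLp_iff {f : ℤ × ℤ → ℂ} {p : ℝ≥0∞} :
    f ∈ harmonicModOneLp p ↔ Memℓp f p ∧ ∀ x, ∃ n : ℤ, act lap f x = n := by
  rw [act_lap]
  rfl

lemma translateSpan_subset {S : Set (ℤ × ℤ → ℂ)} {p : ℝ≥0∞} (hp : 1 ≤ p) (hp' : p ≠ ∞)
    (hS : S ⊆ harmonicModOneLp p) : (translateSpan S : Set (ℤ × ℤ → ℂ)) ⊆ harmonicModOneLp p := by
  intro g hg
  refine Submodule.span_induction (p := fun g _ => g ∈ harmonicModOneLp p) ?_ ?_ ?_ ?_ hg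
  · rintro _ ⟨f, hf, y, rfl⟩
    obtain ⟨h1, h2⟩ := mem_harmonicModOneLp_iff.1 (hS hf)
    rw [mem_harmonicModOneLp_iff]
    refine ⟨h1.translate hp hp' y, fun x => ?_⟩
    obtain ⟨n, hn⟩ := h2 (x - y)
    exact ⟨n, by rw [← act_tau_eq, act_comm, act_tau, hn]⟩
  · rw [mem_harmonicModOneLp_iff]
    exact ⟨zero_memℓp, fun x => ⟨0, by simp⟩⟩
  · intro f g _ _ hf hg
    rw [mem_harmonicModOneLp_iff] at *
    refine ⟨hf.1.add hg.1, fun x => ?_⟩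
    obtain ⟨m, hm⟩ := hf.2 x
    obtain ⟨n, hn⟩ := hg.2 x
    exact ⟨m + n, by rw [map_add, Pi.add_apply, hm, hn]; push_cast; rfl⟩
  · intro c f _ hf
    rw [mem_harmonicModOneLp_iff] at *
    rw [← Int.cast_smul_eq_zsmul ℂ]
    refine ⟨hf.1.const_smul _, fun x => ?_⟩
    obtain ⟨m, hm⟩ := hf.2 x
    exact ⟨c * m, by rw [map_smul, Pi.smul_apply, hm]; push_cast; rfl⟩

/-- Differences of the Green's function of order `k > 2 / p` belong to the space. -/
lemma act_greenZ2_mem {m : LatticeRing} (hm : m ∈ augIdeal) {k : ℕ} (hk : HasDecay m k)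
    {p : ℝ≥0∞} (hp : 1 ≤ p) (hp' : p ≠ ∞) (hkp : 2 < k * p.toReal) :
    act m greenZ2 ∈ harmonicModOneLp p := by
  rw [mem_harmonicModOneLp_iff]
  refine ⟨memℓp_act_greenZ2 hm hk hp hp' hkp, fun x => ⟨m.coeff x, ?_⟩⟩
  rw [act_comm, act_lap_greenZ2, act_basisZero]
  rfl

lemma basisZero_mem (p : ℝ≥0∞) : basisZero ∈ harmonicModOneLp p := by
  rw [mem_harmonicModOneLp_iff, ← latticeFn_one, act_latticeFn]
  exact ⟨memℓp_latticeFn _ _, fun x => ⟨_, rfl⟩⟩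

/-- A function in the space is recovered from its Laplacian by convolution with the Green's
function, as soon as this convolution lies in `ℓ^p`. -/
lemma eq_act_greenZ2 {f : ℤ × ℤ → ℂ} {p : ℝ≥0∞} (hp : 1 ≤ p) (hp' : p ≠ ∞) (hf : Memℓp f p)
    {a : LatticeRing} (ha : act lap f = act a basisZero) (hG : act a greenZ2 ∈ harmonicModOneLp p) :
    f = act a greenZ2 := by
  rw [← sub_eq_zero]
  refine eq_zero_of_harmonic ((hf.sub hG.1).tendsto_cofinite hp hp') ?_
  rw [← act_lap, map_sub, act_comm lap, act_lap_greenZ2, ha, sub_self]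

lemma harmonicModOneLp_eq {S : Set (ℤ × ℤ → ℂ)} {p : ℝ≥0∞} (hp : 1 ≤ p) (hp' : p ≠ ∞)
    (hS : S ⊆ harmonicModOneLp p)
    (hrep : ∀ (f : ℤ × ℤ → ℂ) (a : LatticeRing), Memℓp f p → act lap f = act a basisZero →
      act a greenZ2 ∈ translateSpan S) :
    harmonicModOneLp p = (translateSpan S : Set (ℤ × ℤ → ℂ)) := by
  have hsub := translateSpan_subset hp hp' hS
  refine Set.Subset.antisymm (fun f hf => ?_) hsub
  obtain ⟨a, ha⟩ := exists_act_lap_eq hf hp hp'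
  have hmem := hrep f a hf.1 ha
  rw [eq_act_greenZ2 hp hp' hf.1 ha (hsub hmem)]
  exact hmem

theorem theorem1p4 :
    (∀ x : ℤ × ℤ, ∃ g : ℝ, greenZ2 x = (g : ℂ) ∧
      Tendsto (fun N : ℕ => greenPartialSum N x) atTop (𝓝 g)) ∧
    harmonicModOneLp 1 =
      (translateSpan {discD1 (discD1 (discD1 greenZ2)), discD1 (discD1 (discD2 greenZ2)),
        discD1 (discD2 (discD2 greenZ2)), discD2 (discD2 (discD2 greenZ2)), basisZero} :
          Set (ℤ × ℤ → ℂ)) ∧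
    (∀ p : ℝ≥0∞, 1 < p → p ≤ 2 →
      harmonicModOneLp p =
        (translateSpan {discD1 (discD1 greenZ2), discD1 (discD2 greenZ2),
          discD2 (discD2 greenZ2)} : Set (ℤ × ℤ → ℂ))) ∧
    (∀ p : ℝ≥0∞, 2 < p → p < ∞ →
      harmonicModOneLp p =
        (translateSpan {discD1 greenZ2, discD2 greenZ2} : Set (ℤ × ℤ → ℂ))) := by
  have d1 := hasDecay_diff1
  have d2 := hasDecay_diff2
  have i1 := diff1_mem
  have i2 := diff2_mem
  simp only [← act_diff1, ← act_diff2, ← act_mul]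
  refine ⟨greenZ2_spec, ?_, fun p hp hp2 => ?_, fun p hp hp' => ?_⟩
  · refine harmonicModOneLp_eq le_rfl ENNReal.one_ne_top ?_ fun f a hf ha => ?_
    · have hgen : ∀ {m}, m ∈ augIdeal → HasDecay m (1 + (1 + 1)) →
          act m greenZ2 ∈ harmonicModOneLp 1 := fun hm hk =>
        act_greenZ2_mem hm hk le_rfl ENNReal.one_ne_top (by norm_num)
      rintro _ (rfl | rfl | rfl | rfl | rfl)
      · exact hgen (augIdeal.mul_mem_right _ i1) (d1.mul (d1.mul d1))
      · exact hgen (augIdeal.mul_mem_right _ i1) (d1.mul (d1.mul d2))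
      · exact hgen (augIdeal.mul_mem_right _ i1) (d1.mul (d2.mul d2))
      · exact hgen (augIdeal.mul_mem_right _ i2) (d2.mul (d2.mul d2))
      · exact basisZero_mem 1
    · obtain ⟨c, b₁, b₂, b₃, b₄, rfl⟩ := exists_eq_third_order hf ha
      rw [act_add, act_add, act_add, act_add, act_mul b₁, act_mul b₂, act_mul b₃, act_mul b₄,
        act_mul _ lap, act_lap_greenZ2]
      exact add_mem (add_mem (add_mem (add_mem
        (act_mem_translateSpan (Or.inl rfl) _)
        (act_mem_translateSpan (Or.inr (Or.inl rfl)) _))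
        (act_mem_translateSpan (Or.inr (Or.inr (Or.inl rfl))) _))
        (act_mem_translateSpan (Or.inr (Or.inr (Or.inr (Or.inl rfl)))) _))
        (act_mem_translateSpan (Or.inr (Or.inr (Or.inr (Or.inr rfl)))) _)
  · have htop : p ≠ ∞ := ne_top_of_le_ne_top (by norm_num) hp2
    have hp1 : 1 < p.toReal := by
      rw [← ENNReal.toReal_one]
      exact (ENNReal.toReal_lt_toReal (by norm_num) htop).2 hp
    refine harmonicModOneLp_eq hp.le htop ?_ fun f a hf ha => ?_
    · have hgen : ∀ {m}, m ∈ augIdeal → HasDecay m (1 + 1) →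
          act m greenZ2 ∈ harmonicModOneLp p := fun hm hk =>
        act_greenZ2_mem hm hk hp.le htop (by push_cast; linarith)
      rintro _ (rfl | rfl | rfl)
      · exact hgen (augIdeal.mul_mem_right _ i1) (d1.mul d1)
      · exact hgen (augIdeal.mul_mem_right _ i1) (d1.mul d2)
      · exact hgen (augIdeal.mul_mem_right _ i2) (d2.mul d2)
    · obtain ⟨b₁, b₂, b₃, rfl⟩ := exists_eq_second_order hf hp.le hp2 ha
      rw [act_add, act_add, act_mul b₁, act_mul b₂, act_mul b₃, sq, sq]
      exact add_mem (add_mem (act_mem_translateSpan (Or.inl rfl) _)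
        (act_mem_translateSpan (Or.inr (Or.inl rfl)) _))
        (act_mem_translateSpan (Or.inr (Or.inr rfl)) _)
  · have hp1 : 1 ≤ p := le_trans (by norm_num) hp.le
    have htop : p ≠ ∞ := hp'.ne
    have hp2 : 2 < p.toReal := by
      simpa using (ENNReal.toReal_lt_toReal (by norm_num) htop).2 hp
    refine harmonicModOneLp_eq hp1 htop ?_ fun f a hf ha => ?_
    · rintro _ (rfl | rfl)
      · exact act_greenZ2_mem i1 d1 hp1 htop (by push_cast; linarith)
      · exact act_greenZ2_mem i2 d2 hp1 htop (by push_cast; linarith)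
    · obtain ⟨b₁, b₂, rfl⟩ := exists_eq_first_order hf hp1 htop ha
      rw [act_add, act_mul, act_mul]
      exact add_mem (act_mem_translateSpan (Or.inl rfl) _)
        (act_mem_translateSpan (Or.inr rfl) _)
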